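/- Let $d\ge 1$. A tube $T\subset\mathbb{R}^d$ of width $w(T)>0$ is the $w(T)$-neighbourhood of a line, and a set $A\subset\mathbb{R}^d$ is *tube null* if for every $\delta>0$ it can be covered by countably many tubes $T_j$ with $\sum_j w(T_j)^{d-1}\le\delta$. A *gauge function* is a continuous non-decreasing function $h:(0,\infty)\to(0,\infty)$ with $\lim_{t\downarrow 0}h(t)=0$, and (with the convention $h(0)=0$) $$\mathcal{H}^h(E)=\lim_{\delta\to 0}\inf\Big\{\sum_{i=1}^\infty h(\operatorname{diam}E_i): E\subset\bigcup_i E_i,\ \operatorname{diam}E_i<\delta\Big\}$$ is the Hausdorff measure of $h$. **Theorem 1.2.** There is a constant $C>0$ depending only on $d$ such that the following holds. Let $h$ be a gauge function with $h(2t)\le 2^d h(t)$ for all $t>0$ and $$\int_0^1 t^{-1}\sqrt{t^{1-d}\,|\log t|\,h(t)}\,dt<\infty .$$ Then there is a compact set $A\subset\mathbb{R}^d$ with the following properties: 1. for each integer $n\ge 0$, $A$ can be covered by at most $\max\{1,\,C/h(2^{-n})\}$ closed balls of radius $2^{-n}$; 2. $0<\mathcal{H}^h(A)<\infty$; 3.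 if $B\subset A$ is a Borel set with $\mathcal{H}^h(B)>0$, then $B$ is not tube null. In particular, $A$ is not tube null. Moreover, $A$ is obtained from the following random construction. Let $(a_n)_{n\ge 0}$ be a sequence with $a_n\in\{1,2^d\}$ such that $a_0a_1\cdots a_{n-1}\cdot h(2^{-n})$ is bounded above and bounded away from $0$ uniformly in $n\ge 0$. Put $A_0=[0,1]^d$. Given $A_n$, a union of closed dyadic cubes of side $2^{-n}$, put $A_{n+1}=A_n$ if $a_n=2^d$; if $a_n=1$, choose for each of the cubes forming $A_n$ one of its $2^d$ dyadic sub-cubes of side $2^{-n-1}$, uniformly and independently of each other and of the previous steps, and let $A_{n+1}$ be the union of the chosen sub-cubes. Let $A=\bigcap_n A_n$. For every $h$ as above there is such a sequence $(a_n)$ for which, almost surely, $A$ is compact and satisfies 1, 2 and 3 with the constant $C$. For every such sequence $(a_n)$, almost surely $A$ is compact and satisfies 1, 2 and 3 with $C$ replaced by a non-random constant $C'>0$ (which may depend on $d$, $h$ and $(a_n)$). -/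

import Mathlib

open MeasureTheory Set Filter Topology
open scoped ENNReal

noncomputable section

namespace TubeNull

/-- `d`-dimensional Euclidean space. -/
abbrev E (d : ℕ) : Type := EuclideanSpace ℝ (Fin d)

/-- A (straight, doubly infinite) line in `ℝ^d`. -/
def IsLine {d : ℕ} (L : Set (E d)) : Prop :=
  ∃ p v : E d, v ≠ 0 ∧ L = range fun t : ℝ => p + t • v

/-- `A` is tube null: for every `δ > 0` it is covered by an (at most) countable family of tubes,
given by pairs `(L, w)` where the tube is the `w`-neighbourhood of the line `L` and `w > 0` is
its width, with `∑ w ^ (d - 1) ≤ δ`. -/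
def IsTubeNull {d : ℕ} (A : Set (E d)) : Prop :=
  ∀ δ : ℝ, 0 < δ → ∃ T : Set (Set (E d) × ℝ), T.Countable ∧
    (∀ τ ∈ T, IsLine τ.1 ∧ 0 < τ.2) ∧
    (A ⊆ ⋃ τ ∈ T, Metric.thickening τ.2 τ.1) ∧
    (∑' τ : T, ENNReal.ofReal (τ.1.2 ^ (d - 1))) ≤ ENNReal.ofReal δ

/-- `h : (0,∞) → (0,∞)` is a gauge function: non-decreasing, continuous, with limit `0` at `0+`.
Only the values of `h` on `(0,∞)` matter. -/
structure IsGauge (h : ℝ → ℝ) : Prop where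
  pos : ∀ t, 0 < t → 0 < h t
  mono : MonotoneOn h (Ioi 0)
  cont : ContinuousOn h (Ioi 0)
  tendsto_zero : Tendsto h (𝓝[>] 0) (𝓝 0)

/-- A gauge function as a function of a diameter in `[0,∞]`, with the usual convention
`h(0) = h(0+) = 0`. The value at `∞` is irrelevant for the Hausdorff measure. -/
def gaugeENN (h : ℝ → ℝ) (x : ℝ≥0∞) : ℝ≥0∞ :=
  if x = 0 then 0 else if x = ∞ then ∞ else ENNReal.ofReal (h x.toReal)

/-- The Hausdorff measure `𝓗^h` on `ℝ^d` of the gauge function `h`. -/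
def hausdorffGauge (d : ℕ) (h : ℝ → ℝ) : Measure (E d) :=
  Measure.mkMetric (gaugeENN h)

/-- `A` has the asserted properties for the gauge function `h` with the covering constant `C`. -/
structure IsNonTubeNullSet {d : ℕ} (h : ℝ → ℝ) (C : ℝ) (A : Set (E d)) : Prop where
  isCompact : IsCompact A
  /-- For each `n`, the set `A` is covered by at most `max 1 (C / h(2^{-n}))` balls of
  radius `2^{-n}`. -/
  cover : ∀ n : ℕ, ∃ c : Finset (E d), (c.card : ℝ) ≤ max 1 (C / h ((2 : ℝ)⁻¹ ^ n)) ∧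
    A ⊆ ⋃ x ∈ c, Metric.closedBall x ((2 : ℝ)⁻¹ ^ n)
  measure_pos : 0 < hausdorffGauge d h A
  measure_lt_top : hausdorffGauge d h A < ∞
  /-- No Borel subset of positive measure is tube null. -/
  not_isTubeNull_of_subset : ∀ B : Set (E d), B ⊆ A → MeasurableSet B →
    0 < hausdorffGauge d h B → ¬ IsTubeNull B
  /-- In particular, `A` is not tube null. -/
  not_isTubeNull : ¬ IsTubeNull A

/-! ### The random dyadic construction -/

/-- The closed dyadic cube `∏ i, [k i / 2^n, (k i + 1) / 2^n]` of side length `2^{-n}`. -/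
def dyadicCube {d : ℕ} (n : ℕ) (k : Fin d → ℕ) : Set (E d) :=
  {x | ∀ i, (k i : ℝ) / 2 ^ n ≤ x i ∧ x i ≤ ((k i : ℝ) + 1) / 2 ^ n}

/-- `a₀, a₁, …` is a sequence in `{1, 2^d}` with
`P_n = a₀ ⋯ a_{n-1} = Θ(1 / h(2^{-n}))`. -/
structure IsBranchingSequence (d : ℕ) (h : ℝ → ℝ) (a : ℕ → ℕ) : Prop where
  mem : ∀ n, a n = 1 ∨ a n = 2 ^ d
  theta : ∃ K : ℝ, 0 < K ∧ ∀ n : ℕ,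
    K⁻¹ / h ((2 : ℝ)⁻¹ ^ n) ≤ ∏ i ∈ Finset.range n, (a i : ℝ) ∧
      ∏ i ∈ Finset.range n, (a i : ℝ) ≤ K / h ((2 : ℝ)⁻¹ ^ n)

/-- The sample space: to each level `n` and each dyadic cube `k` of level `n` a choice of one of
its `2^d` dyadic sub-cubes of level `n + 1`. -/
abbrev Choices (d : ℕ) : Type := ℕ × (Fin d → ℕ) → (Fin d → Fin 2)

/-- All choices are uniform and independent. -/
def choiceMeasure (d : ℕ) : Measure (Choices d) :=
  Measure.infinitePi fun _ => (PMF.uniformOfFintype (Fin d → Fin 2)).toMeasure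

/-- The (indices of the) dyadic cubes of level `n` that form the set `A_n`. At step `n` all the
sub-cubes of a cube are kept if `a n = 2^d`, and only the chosen one if `a n = 1`. -/
def survivors {d : ℕ} (a : ℕ → ℕ) (ω : Choices d) : ℕ → Set (Fin d → ℕ)
  | 0 => {0}
  | n + 1 => {k | (fun i => k i / 2) ∈ survivors a ω n ∧
      (a n = 1 → ∀ i, k i % 2 = (ω (n, fun j => k j / 2) i : ℕ))}

/-- `A_n`, the union of the surviving cubes of level `n`. -/
def stageSet {d : ℕ} (a : ℕ → ℕ) (ω : Choices d) (n : ℕ) : Set (E d) :=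
  ⋃ k ∈ survivors a ω n, dyadicCube n k

/-- The random set `A = ⋂ n, A_n`. -/
def limitSet {d : ℕ} (a : ℕ → ℕ) (ω : Choices d) : Set (E d) :=
  ⋂ n, stageSet a ω n

end TubeNull

end

/-! Spread unit mass evenly over the P_n = `pop a n` surviving cubes of level n, that is, with
density `dens d a n` = 2^(dn) / P_n. Along a fixed sampled line the average of this density is a
martingale in n: nothing changes when `a n = 2 ^ d`, and when `a n = 1` every surviving cube
contributes an independent centred increment, bounded in terms of the time that the line spends in
the cube, a fraction of at most 2^(-n). By Hoeffding, an average Y grows by more than ε max(1, Y)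
with probability at most exp(-2 ε² 2^n / (4^d dens)). Only exp(O(n)) lines have to be distinguished
at level n, so Borel–Cantelli applies with ε_n of order sqrt(n dens / 2^n), i.e. sqrt(n 2^(n(d-1))
h(2^(-n))), and the integral condition says that these ε_n are summable. Hence almost surely all
averages along all lines have a common bound M (`ae_exists_lineAverage_le`).

To have finitely many lines per level, a line is recorded only through the dyadic cells visited at
finitely many sample times. In each coordinate this record is the trace of a half-plane on a grid,
so Sauer–Shelah counts the records (`exists_finset_graphLines`). Passing to finer sample times costs
little because coordinates are monotone along a line (`sum_cellPath_refine_le`).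

The bound on lines shows that a tube of width w meets at most a multiple of M w^(d-1) P_n cubes at
all late levels (`eventually_card_meet_tube_le`). The limit measure is never constructed: its role
is played by the fraction of surviving cubes that meet a set, which does not increase with the level
(`card_meet_div_pop_le`). Eventual fractions dominate the gauge measure of subsets of A
(`hausdorffGauge_le`), so a compact subset covered by tubes with Σ w^(d-1) ≤ δ has measure O(δ);
inner regularity passes to Borel sets. Positivity of the measure is the mass distribution principle
for the same fractions (`hausdorffGauge_limitSet_pos`). -/

namespace TubeNull

variable {d : ℕ} {a : ℕ → ℕ} {ω : Choices d}

/-! ### Combinatorics of the surviving cubes -/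

/-- The number `a₀ ⋯ a_{n-1}` of surviving cubes of level `n`. -/
def pop (a : ℕ → ℕ) (n : ℕ) : ℕ := ∏ i ∈ Finset.range n, a i

lemma pop_succ (a : ℕ → ℕ) (n : ℕ) : pop a (n + 1) = pop a n * a n :=
  Finset.prod_range_succ _ _

lemma pop_zero (a : ℕ → ℕ) : pop a 0 = 1 := by simp [pop]

lemma pop_pos (ha : ∀ n, a n = 1 ∨ a n = 2 ^ d) (n : ℕ) : 0 < pop a n := by
  refine Finset.prod_pos fun i _ => ?_
  rcases ha i with h | h <;> rw [h]
  · exact one_pos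
  · positivity

lemma survivors_lt (n : ℕ) : ∀ k ∈ survivors a ω n, ∀ i, k i < 2 ^ n := by
  induction n with
  | zero =>
    intro k hk i
    simp only [survivors, mem_singleton_iff] at hk
    simp [hk]
  | succ n ih =>
    intro k hk i
    have := ih _ hk.1 i
    change k i / 2 < 2 ^ n at this
    rw [pow_succ]
    omega

/-- The surviving cubes of level `n`, as a finite set. -/
noncomputable def surv (a : ℕ → ℕ) (ω : Choices d) (n : ℕ) : Finset (Fin d → ℕ) := by
  classical
  exact (Fintype.piFinset fun _ => Finset.range (2 ^ n)).filter (· ∈ survivors a ω n)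

lemma mem_surv {n : ℕ} {k : Fin d → ℕ} : k ∈ surv a ω n ↔ k ∈ survivors a ω n := by
  classical
  simp only [surv, Finset.mem_filter, Fintype.mem_piFinset, Finset.mem_range,
    and_iff_right_iff_imp]
  exact fun h => survivors_lt n k h

lemma surv_zero : surv a ω 0 = {0} := by
  ext k
  simp [mem_surv, survivors]

/-- The dyadic ancestor `j` levels above. -/
def ancestor (j : ℕ) (k : Fin d → ℕ) : Fin d → ℕ := fun i => k i / 2 ^ j

/-- The sub-cube with digits `e`. -/
def child (k : Fin d → ℕ) (e : Fin d → Fin 2) : Fin d → ℕ := fun i => 2 * k i + (e i : ℕ)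

lemma ancestor_one_child (k : Fin d → ℕ) (e : Fin d → Fin 2) : ancestor 1 (child k e) = k := by
  ext i
  have := (e i).isLt
  simp only [ancestor, child, pow_one]
  omega

lemma child_injective (k : Fin d → ℕ) : Function.Injective (child k) := by
  intro e e' h
  ext i
  have := congrFun h i
  simp only [child] at this
  omega

lemma exists_eq_child {k κ : Fin d → ℕ} (h : ancestor 1 k = κ) : ∃ e, k = child κ e := by
  refine ⟨fun i => ⟨k i % 2, Nat.mod_lt _ two_pos⟩, ?_⟩
  ext i
  have := congrFun h i
  simp only [ancestor, pow_one] at this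
  simp only [child]
  omega

lemma mem_surv_succ {n : ℕ} {k : Fin d → ℕ} :
    k ∈ surv a ω (n + 1) ↔ ancestor 1 k ∈ surv a ω n ∧
      (a n = 1 → k = child (ancestor 1 k) (ω (n, ancestor 1 k))) := by
  have e : (fun i => k i / 2) = ancestor 1 k := by ext i; simp [ancestor]
  simp only [mem_surv, survivors, mem_ofPred_eq, e]
  refine and_congr_right fun _ => imp_congr_right fun _ => ?_
  rw [funext_iff]
  refine forall_congr' fun i => ?_
  simp only [child]
  simp only [ancestor, pow_one]
  omega

lemma child_mem_surv {n : ℕ} {κ : Fin d → ℕ} {e : Fin d → Fin 2} :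
    child κ e ∈ surv a ω (n + 1) ↔ κ ∈ surv a ω n ∧ (a n = 1 → e = ω (n, κ)) := by
  rw [mem_surv_succ, ancestor_one_child, (child_injective κ).eq_iff]

lemma surv_succ_of_eq_one {n : ℕ} (h : a n = 1) :
    surv a ω (n + 1) = (surv a ω n).image fun κ => child κ (ω (n, κ)) := by
  ext k
  rw [mem_surv_succ, Finset.mem_image]
  constructor
  · rintro ⟨h1, h2⟩
    exact ⟨_, h1, (h2 h).symm⟩
  · rintro ⟨κ, hκ, rfl⟩
    rw [ancestor_one_child]
    exact ⟨hκ, fun _ => rfl⟩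

/-- All survivors have equally many children, whatever the choices. This makes the population
deterministic and the fractions of cubes meeting a set monotone in the level. -/
lemma card_fiber {n : ℕ} (ha : a n = 1 ∨ a n = 2 ^ d) {κ : Fin d → ℕ} (hκ : κ ∈ surv a ω n) :
    ((surv a ω (n + 1)).filter fun k => ancestor 1 k = κ).card = a n := by
  classical
  by_cases h1 : a n = 1
  · rw [h1, Finset.card_eq_one]
    refine ⟨child κ (ω (n, κ)), ?_⟩
    ext k
    rw [Finset.mem_filter, Finset.mem_singleton, mem_surv_succ]
    constructor
    · rintro ⟨⟨_, h⟩, rfl⟩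
      exact h h1
    · rintro rfl
      rw [ancestor_one_child]
      exact ⟨⟨hκ, fun _ => rfl⟩, rfl⟩
  · have h2 : a n = 2 ^ d := ha.resolve_left h1
    have : (surv a ω (n + 1)).filter (fun k => ancestor 1 k = κ)
        = Finset.univ.image (child κ) := by
      ext k
      rw [Finset.mem_filter, Finset.mem_image]
      constructor
      · rintro ⟨_, h⟩
        obtain ⟨e, rfl⟩ := exists_eq_child h
        exact ⟨e, Finset.mem_univ _, rfl⟩
      · rintro ⟨e, _, rfl⟩
        exact ⟨child_mem_surv.2 ⟨hκ, fun h => absurd h h1⟩, ancestor_one_child _ _⟩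
    rw [this, Finset.card_image_of_injective _ (child_injective κ), h2]
    simp

lemma card_surv (ha : ∀ n, a n = 1 ∨ a n = 2 ^ d) (n : ℕ) : (surv a ω n).card = pop a n := by
  induction n with
  | zero => simp [surv_zero, pop_zero]
  | succ n ih =>
    have hmap : ∀ k ∈ surv a ω (n + 1), ancestor 1 k ∈ surv a ω n := fun k hk =>
      (mem_surv_succ.1 hk).1
    rw [Finset.card_eq_sum_card_fiberwise hmap, Finset.sum_congr rfl fun κ hκ =>
      card_fiber (ha n) hκ, Finset.sum_const, ih, pop_succ, smul_eq_mul]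

lemma dyadicCube_succ_subset (n : ℕ) (k : Fin d → ℕ) :
    dyadicCube (n + 1) k ⊆ dyadicCube n (ancestor 1 k) := by
  intro x hx i
  obtain ⟨h1, h2⟩ := hx i
  have hp : (0 : ℝ) < 2 ^ n := by positivity
  rw [div_le_iff₀ (by positivity), pow_succ] at h1
  rw [le_div_iff₀ (by positivity), pow_succ] at h2
  have e1 : 2 * (k i / 2) ≤ k i := by omega
  have e2 : k i ≤ 2 * (k i / 2) + 1 := by omega
  have e1' : (2 : ℝ) * ((k i / 2 : ℕ) : ℝ) ≤ k i := by exact_mod_cast e1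
  have e2' : (k i : ℝ) ≤ 2 * ((k i / 2 : ℕ) : ℝ) + 1 := by exact_mod_cast e2
  simp only [ancestor, pow_one]
  rw [div_le_iff₀ hp, le_div_iff₀ hp]
  constructor <;> nlinarith

/-- The surviving cubes of level `n` that meet `T`. -/
noncomputable def meet (a : ℕ → ℕ) (ω : Choices d) (n : ℕ) (T : Set (E d)) :
    Finset (Fin d → ℕ) := by
  classical
  exact (surv a ω n).filter fun k => (dyadicCube n k ∩ T).Nonempty

lemma mem_meet {n : ℕ} {T : Set (E d)} {k : Fin d → ℕ} :
    k ∈ meet a ω n T ↔ k ∈ surv a ω n ∧ (dyadicCube n k ∩ T).Nonempty := by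
  classical
  simp [meet]

lemma card_meet_succ_le (ha : ∀ n, a n = 1 ∨ a n = 2 ^ d) (n : ℕ) (T : Set (E d)) :
    (meet a ω (n + 1) T).card ≤ (meet a ω n T).card * a n := by
  classical
  have hmap : ∀ k ∈ meet a ω (n + 1) T, ancestor 1 k ∈ meet a ω n T := by
    intro k hk
    obtain ⟨h1, h2⟩ := mem_meet.1 hk
    exact mem_meet.2 ⟨(mem_surv_succ.1 h1).1,
      h2.mono (inter_subset_inter_left _ (dyadicCube_succ_subset n k))⟩
  rw [Finset.card_eq_sum_card_fiberwise hmap, ← smul_eq_mul]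
  refine Finset.sum_le_card_nsmul _ _ _ fun κ hκ => ?_
  rw [← card_fiber (ha n) (mem_meet.1 hκ).1]
  refine Finset.card_le_card fun k hk => ?_
  rw [Finset.mem_filter] at hk ⊢
  exact ⟨(mem_meet.1 hk.1).1, hk.2⟩

lemma card_meet_add_mul_le (ha : ∀ n, a n = 1 ∨ a n = 2 ^ d) (n j : ℕ) (T : Set (E d)) :
    (meet a ω (n + j) T).card * pop a n ≤ (meet a ω n T).card * pop a (n + j) := by
  induction j with
  | zero => simp
  | succ j ih =>
    rw [← add_assoc, pop_succ]
    calc _ ≤ ((meet a ω (n + j) T).card * a (n + j)) * pop a n :=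
          Nat.mul_le_mul_right _ (card_meet_succ_le ha _ T)
      _ = ((meet a ω (n + j) T).card * pop a n) * a (n + j) := by ring
      _ ≤ ((meet a ω n T).card * pop a (n + j)) * a (n + j) := Nat.mul_le_mul_right _ ih
      _ = _ := by ring

/-- The substitute for the natural measure: a bound on the fraction at the scale of a tube or ball
persists at all finer levels. -/
lemma card_meet_div_pop_le (ha : ∀ n, a n = 1 ∨ a n = 2 ^ d) {n N : ℕ} (h : n ≤ N)
    (T : Set (E d)) :
    ((meet a ω N T).card : ℝ) / pop a N ≤ ((meet a ω n T).card : ℝ) / pop a n := by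
  obtain ⟨j, rfl⟩ := Nat.exists_eq_add_of_le h
  rw [div_le_div_iff₀ (by exact_mod_cast pop_pos ha _) (by exact_mod_cast pop_pos ha _)]
  exact_mod_cast card_meet_add_mul_le ha n j T

lemma card_meet_le_pop (ha : ∀ n, a n = 1 ∨ a n = 2 ^ d) (n : ℕ) (T : Set (E d)) :
    (meet a ω n T).card ≤ pop a n := by
  rw [← card_surv (ω := ω) ha n]
  exact Finset.card_le_card fun k hk => (mem_meet.1 hk).1

lemma card_meet_le_sum {ι : Type*} (s : Finset ι) (n : ℕ) (K : Set (E d)) (T : ι → Set (E d))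
    (h : K ⊆ ⋃ i ∈ s, T i) : (meet a ω n K).card ≤ ∑ i ∈ s, (meet a ω n (T i)).card := by
  classical
  refine (Finset.card_le_card (t := s.biUnion fun i => meet a ω n (T i)) fun k hk => ?_).trans
    Finset.card_biUnion_le
  obtain ⟨h1, x, hx, hxK⟩ := mem_meet.1 hk
  obtain ⟨i, hi, hxi⟩ := mem_iUnion₂.1 (h hxK)
  exact Finset.mem_biUnion.2 ⟨i, hi, mem_meet.2 ⟨h1, x, hx, hxi⟩⟩

/-! ### Topology of the stages -/

lemma isCompact_dyadicCube (n : ℕ) (k : Fin d → ℕ) : IsCompact (dyadicCube n k) := by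
  have h : dyadicCube n k = (PiLp.homeomorph 2 fun _ : Fin d => ℝ) ⁻¹'
      (Set.pi univ fun i => Icc ((k i : ℝ) / 2 ^ n) (((k i : ℝ) + 1) / 2 ^ n)) := by
    ext x
    simp only [dyadicCube, mem_ofPred_eq, mem_preimage, mem_univ_pi, mem_Icc]
    rfl
  rw [h, Homeomorph.isCompact_preimage]
  exact isCompact_univ_pi fun i => isCompact_Icc

lemma dyadicCube_nonempty (n : ℕ) (k : Fin d → ℕ) : (dyadicCube n k).Nonempty := by
  refine ⟨WithLp.toLp 2 fun i => (k i : ℝ) / 2 ^ n, fun i => ⟨le_rfl, ?_⟩⟩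
  simp only
  gcongr
  linarith

lemma stageSet_eq (n : ℕ) : stageSet a ω n = ⋃ k ∈ surv a ω n, dyadicCube n k := by
  simp only [stageSet, mem_surv]

lemma isCompact_stageSet (n : ℕ) : IsCompact (stageSet a ω n) := by
  rw [stageSet_eq]
  exact (surv a ω n).isCompact_biUnion fun k _ => isCompact_dyadicCube n k

lemma stageSet_antitone : Antitone (stageSet a ω) := by
  refine antitone_nat_of_succ_le fun n => ?_
  simp only [stageSet_eq]
  refine iUnion₂_subset fun k hk => (dyadicCube_succ_subset n k).trans ?_
  exact subset_biUnion_of_mem (u := fun k => dyadicCube n k)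
    (show ancestor 1 k ∈ surv a ω n from (mem_surv_succ.1 hk).1)

lemma isCompact_limitSet : IsCompact (limitSet a ω) :=
  (isCompact_stageSet 0).of_isClosed_subset
    (isClosed_iInter fun n => (isCompact_stageSet n).isClosed) (iInter_subset _ 0)

lemma limitSet_subset_meet (n : ℕ) {K : Set (E d)} (hK : K ⊆ limitSet a ω) :
    K ⊆ ⋃ k ∈ meet a ω n K, dyadicCube n k := by
  intro x hx
  have h := mem_iInter.1 (hK hx) n
  rw [stageSet_eq] at h
  obtain ⟨k, hk, hxk⟩ := mem_iUnion₂.1 h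
  exact mem_iUnion₂.2 ⟨k, mem_meet.2 ⟨hk, x, hxk, hx⟩, hxk⟩

lemma exists_stageSet_subset {U : Set (E d)} (hU : IsOpen U) (h : limitSet a ω ⊆ U) :
    ∃ n, stageSet a ω n ⊆ U :=
  exists_subset_nhds_of_isCompact stageSet_antitone.directed_ge
    (fun n => isCompact_stageSet n) fun _ hx => hU.mem_nhds (h hx)

lemma dist_le_of_mem_dyadicCube {n : ℕ} {k : Fin d → ℕ} {x y : E d} (hx : x ∈ dyadicCube n k)
    (hy : y ∈ dyadicCube n k) : dist x y ≤ √d * (2 : ℝ)⁻¹ ^ n := by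
  rw [EuclideanSpace.dist_eq]
  have h : ∑ i, dist (x i) (y i) ^ 2 ≤ ∑ _i : Fin d, ((2 : ℝ)⁻¹ ^ n) ^ 2 := by
    refine Finset.sum_le_sum fun i _ => ?_
    obtain ⟨h1, h2⟩ := hx i
    obtain ⟨h3, h4⟩ := hy i
    have : ((k i : ℝ) + 1) / 2 ^ n = (k i : ℝ) / 2 ^ n + 2⁻¹ ^ n := by
      rw [add_div, inv_pow, one_div]
    gcongr
    rw [Real.dist_eq, abs_le]
    constructor <;> linarith
  refine (Real.sqrt_le_sqrt h).trans ?_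
  rw [Finset.sum_const, Finset.card_univ, Fintype.card_fin, nsmul_eq_mul,
    Real.sqrt_mul (by positivity), Real.sqrt_sq (by positivity)]

/-! ### Sampled lines and their cell paths -/

/-- If the middle point lies on or below the chord of the outer two, a line above both outer points
is above it too, so the outer pair cannot be cut off alone; otherwise the middle point cannot. If
the abscissas all agree, the higher of two points never occurs without the lower. -/
lemma not_shatters_of_sorted {α : Type*} [DecidableEq α] (s y : α → ℝ)
    {𝒜 : Finset (Finset α)} (h : ∀ A ∈ 𝒜, ∃ p v : ℝ, ∀ x, x ∈ A ↔ y x ≤ p + v * s x)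
    {x₁ x₂ x₃ : α} (h12 : x₁ ≠ x₂) (h23 : x₂ ≠ x₃) (hs12 : s x₁ ≤ s x₂) (hs23 : s x₂ ≤ s x₃) :
    ¬ 𝒜.Shatters {x₁, x₂, x₃} := by
  intro hsh
  by_cases hs : s x₁ = s x₃
  · have e2 : s x₂ = s x₁ := by linarith
    rcases le_total (y x₁) (y x₂) with hy | hy
    · obtain ⟨A, hA, hAe⟩ := hsh (t := {x₂}) (by simp)
      obtain ⟨p, v, hpv⟩ := h A hA
      have m2 : x₂ ∈ A := Finset.mem_of_mem_inter_right (hAe ▸ Finset.mem_singleton_self x₂)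
      have n1 : x₁ ∉ A := fun hx => h12 <| by
        simpa using (hAe ▸ Finset.mem_inter.2 ⟨by simp, hx⟩ : x₁ ∈ ({x₂} : Finset α))
      rw [hpv] at m2 n1
      rw [e2] at m2
      linarith
    · obtain ⟨A, hA, hAe⟩ := hsh (t := {x₁}) (by simp)
      obtain ⟨p, v, hpv⟩ := h A hA
      have m1 : x₁ ∈ A := Finset.mem_of_mem_inter_right (hAe ▸ Finset.mem_singleton_self x₁)
      have n2 : x₂ ∉ A := fun hx => h12.symm <| by
        simpa using (hAe ▸ Finset.mem_inter.2 ⟨by simp, hx⟩ : x₂ ∈ ({x₁} : Finset α))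
      rw [hpv] at m1 n2
      rw [e2] at n2
      linarith
  · have h13 : x₁ ≠ x₃ := fun e => hs (by rw [e])
    have hlt : 0 < s x₃ - s x₁ := by
      rcases lt_or_eq_of_le (hs12.trans hs23) with h' | h'
      · linarith
      · exact absurd h' hs
    rcases le_or_gt (y x₂ * (s x₃ - s x₁))
      (y x₁ * (s x₃ - s x₂) + y x₃ * (s x₂ - s x₁)) with hy | hy
    · obtain ⟨A, hA, hAe⟩ := hsh (t := {x₁, x₃}) (by intro z; simp; tauto)
      obtain ⟨p, v, hpv⟩ := h A hA
      have m1 : x₁ ∈ A := Finset.mem_of_mem_inter_right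
        (hAe ▸ (by simp : x₁ ∈ ({x₁, x₃} : Finset α)))
      have m3 : x₃ ∈ A := Finset.mem_of_mem_inter_right
        (hAe ▸ (by simp : x₃ ∈ ({x₁, x₃} : Finset α)))
      have n2 : x₂ ∉ A := fun hx => by
        have : x₂ ∈ ({x₁, x₃} : Finset α) := hAe ▸ Finset.mem_inter.2 ⟨by simp, hx⟩
        simp only [Finset.mem_insert, Finset.mem_singleton] at this
        exact this.elim h12.symm h23
      rw [hpv] at m1 m3 n2
      push Not at n2
      have a1 := mul_le_mul_of_nonneg_right m1 (sub_nonneg.2 hs23)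
      have a3 := mul_le_mul_of_nonneg_right m3 (sub_nonneg.2 hs12)
      have a2 := mul_lt_mul_of_pos_right n2 hlt
      nlinarith
    · obtain ⟨A, hA, hAe⟩ := hsh (t := {x₂}) (by simp)
      obtain ⟨p, v, hpv⟩ := h A hA
      have m2 : x₂ ∈ A := Finset.mem_of_mem_inter_right (hAe ▸ Finset.mem_singleton_self x₂)
      have n1 : x₁ ∉ A := fun hx => h12 <| by
        simpa using (hAe ▸ Finset.mem_inter.2 ⟨by simp, hx⟩ : x₁ ∈ ({x₂} : Finset α))
      have n3 : x₃ ∉ A := fun hx => h23.symm <| by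
        simpa using (hAe ▸ Finset.mem_inter.2 ⟨by simp, hx⟩ : x₃ ∈ ({x₂} : Finset α))
      rw [hpv] at m2 n1 n3
      push Not at n1 n3
      have a1 := mul_le_mul_of_nonneg_right n1.le (sub_nonneg.2 hs23)
      have a3 := mul_le_mul_of_nonneg_right n3.le (sub_nonneg.2 hs12)
      have a2 := mul_le_mul_of_nonneg_right m2 hlt.le
      nlinarith

/-- A family of half-plane traces on a finite point set has at most quadratic size. -/
lemma card_halfplane_traces_le {α : Type*} [Fintype α] [DecidableEq α] (s y : α → ℝ)
    {𝒜 : Finset (Finset α)} (h : ∀ A ∈ 𝒜, ∃ p v : ℝ, ∀ x, x ∈ A ↔ y x ≤ p + v * s x) :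
    𝒜.card ≤ (Fintype.card α + 1) ^ 2 := by
  have hvc : 𝒜.vcDim ≤ 2 := by
    refine Finset.sup_le fun t ht => ?_
    rw [Finset.mem_shatterer] at ht
    by_contra! hcard
    obtain ⟨u, hut, hu⟩ := Finset.exists_subset_card_eq (show 3 ≤ t.card from hcard)
    obtain ⟨x, y', z, hxy, hxz, hyz, rfl⟩ := Finset.card_eq_three.1 hu
    have hsh := ht.mono_right hut
    have key : ∀ {x₁ x₂ x₃ : α}, x₁ ≠ x₂ → x₂ ≠ x₃ → s x₁ ≤ s x₂ → s x₂ ≤ s x₃ →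
        ({x₁, x₂, x₃} : Finset α) = {x, y', z} → False := fun h1 h2 h3 h4 he =>
      not_shatters_of_sorted s y h h1 h2 h3 h4 (he ▸ hsh)
    -- The cases only sort the three points by abscissa.
    rcases le_total (s x) (s y') with a1 | a1 <;> rcases le_total (s y') (s z) with a2 | a2 <;>
      rcases le_total (s x) (s z) with a3 | a3
    · exact key hxy hyz a1 a2 rfl
    · exact key hxy hyz a1 a2 rfl
    · exact key hxz hyz.symm a3 a2 (by ext w; simp; tauto)
    · exact key hxz.symm hxy a3 a1 (by ext w; simp; tauto)
    · exact key hxy.symm hxz a1 a3 (by ext w; simp; tauto)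
    · exact key hyz hxz.symm a2 a3 (by ext w; simp; tauto)
    · exact key hyz.symm hxy.symm a2 a1 (by ext w; simp; tauto)
    · exact key hyz.symm hxy.symm a2 a1 (by ext w; simp; tauto)
  have h3 := 𝒜.card_le_card_shatterer.trans 𝒜.card_shatterer_le_sum_vcDim
  have hI : (Finset.Iic 2 : Finset ℕ) = {0, 1, 2} := by decide
  refine h3.trans ((Finset.sum_le_sum_of_subset (Finset.Iic_subset_Iic.2 hvc)).trans ?_)
  rw [hI, Finset.sum_insert (by simp), Finset.sum_insert (by simp), Finset.sum_singleton]
  have := Nat.choose_le_pow (Fintype.card α) 2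
  simp only [Nat.choose_zero_right, Nat.choose_one_right]
  nlinarith

/-- A parametrized line `s ↦ p + s v` whose `j`-th coordinate is dominant and equal to the
parameter, and whose base point is bounded. -/
structure IsGraphLine (j : Fin d) (p v : Fin d → ℝ) : Prop where
  base : p j = 0
  slope : v j = 1
  slope_le : ∀ i, |v i| ≤ 1
  base_le : ∀ i, |p i| ≤ 8

/-- The dyadic cells of level `n` that the line `p + s v` visits at the times `s = j / m`. -/
noncomputable def cellPath (n m : ℕ) (p v : Fin d → ℝ) (j : ℕ) : Fin d → ℤ :=
  fun i => ⌊2 ^ n * (p i + v i * (j / m : ℝ))⌋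

/-- Up to their sampled cell paths there are only polynomially many graph lines. -/
lemma exists_finset_graphLines (j₀ : Fin d) (n m : ℕ) :
    ∃ F : Finset ((Fin d → ℝ) × (Fin d → ℝ)),
      F.card ≤ ((m * (20 * 2 ^ n + 1) + 1) ^ 2) ^ d ∧ (∀ l ∈ F, IsGraphLine j₀ l.1 l.2) ∧
      ∀ p v, IsGraphLine j₀ p v →
        ∃ l ∈ F, ∀ j < m, cellPath n m p v j = cellPath n m l.1 l.2 j := by
  classical
  -- At times in [0, 1] the coordinates of a graph line are at most 8 + 1 in absolute value, so its
  -- cell indices lie between -10 · 2^n and 10 · 2^n. The grid pairs sample times with these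
  -- integers; a cell index is the highest grid point of its column not above the line, so the
  -- traces `W` determine the cell path.
  let α := Fin m × Fin (20 * 2 ^ n + 1)
  let s : α → ℝ := fun x => 2 ^ n * (x.1 / m : ℝ)
  let y : α → ℝ := fun x => (x.2 : ℝ) - 10 * 2 ^ n
  let W : ℝ → ℝ → Finset α := fun p v => Finset.univ.filter fun x => y x ≤ 2 ^ n * p + v * s x
  let 𝒜 : Finset (Finset α) := Finset.univ.filter fun A => ∃ p v, A = W p v
  have hA : 𝒜.card ≤ (Fintype.card α + 1) ^ 2 := by
    refine card_halfplane_traces_le s y fun A hA => ?_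
    obtain ⟨p, v, rfl⟩ := (Finset.mem_filter.1 hA).2
    exact ⟨2 ^ n * p, v, fun x => by simp [W]⟩
  let T : Finset (Fin d → Finset α) := Fintype.piFinset fun _ => 𝒜
  let P : (Fin d → ℝ) × (Fin d → ℝ) → Fin d → Finset α := fun l i => W (l.1 i) (l.2 i)
  let T' := T.filter fun t => ∃ l, IsGraphLine j₀ l.1 l.2 ∧ P l = t
  -- One representative per realised tuple of traces; the value 0 elsewhere is never used.
  have hch : ∀ t : Fin d → Finset α, ∃ l : (Fin d → ℝ) × (Fin d → ℝ),
      t ∈ T' → IsGraphLine j₀ l.1 l.2 ∧ P l = t := by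
    intro t
    by_cases ht : t ∈ T'
    · obtain ⟨l, hl⟩ := (Finset.mem_filter.1 ht).2
      exact ⟨l, fun _ => hl⟩
    · exact ⟨0, fun h => absurd h ht⟩
  choose c hc using hch
  refine ⟨T'.image c, ?_, ?_, ?_⟩
  · calc (T'.image c).card ≤ T'.card := Finset.card_image_le
      _ ≤ T.card := Finset.card_filter_le _ _
      _ = 𝒜.card ^ d := by simp [T]
      _ ≤ ((Fintype.card α + 1) ^ 2) ^ d := Nat.pow_le_pow_left hA d
      _ = _ := by simp [α]
  · intro l hl
    obtain ⟨t, ht, rfl⟩ := Finset.mem_image.1 hl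
    exact (hc t ht).1
  · intro p v hpv
    have hmem : P (p, v) ∈ T' := Finset.mem_filter.2
      ⟨Fintype.mem_piFinset.2 fun i => Finset.mem_filter.2 ⟨Finset.mem_univ _, _, _, rfl⟩,
        (p, v), hpv, rfl⟩
    refine ⟨c (P (p, v)), Finset.mem_image_of_mem c hmem, fun j hj => ?_⟩
    obtain ⟨hl, hPl⟩ := hc _ hmem
    have key : ∀ p₁ v₁ p₂ v₂ : Fin d → ℝ, IsGraphLine j₀ p₁ v₁ → P (p₁, v₁) = P (p₂, v₂) →
        ∀ i, cellPath n m p₁ v₁ j i ≤ cellPath n m p₂ v₂ j i := by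
      intro p₁ v₁ p₂ v₂ h1 hP i
      have hmpos : (0 : ℝ) < m := by exact_mod_cast (Nat.zero_le j).trans_lt hj
      have hjm : (j / m : ℝ) ≤ 1 := (div_le_one hmpos).2 (by exact_mod_cast hj.le)
      have hjm0 : (0 : ℝ) ≤ j / m := by positivity
      have hval : |p₁ i + v₁ i * (j / m : ℝ)| ≤ 9 := by
        refine (abs_add_le _ _).trans ?_
        rw [abs_mul, abs_of_nonneg hjm0]
        have := mul_le_mul (h1.slope_le i) hjm hjm0 zero_le_one
        linarith [h1.base_le i]
      rw [abs_le] at hval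
      have h2n : (0 : ℝ) < 2 ^ n := by positivity
      set c₁ := cellPath n m p₁ v₁ j i with hc₁
      have hfl : (c₁ : ℝ) ≤ 2 ^ n * (p₁ i + v₁ i * (j / m : ℝ)) := Int.floor_le _
      have hlo : -(10 * 2 ^ n) ≤ c₁ := by
        rw [hc₁]
        refine Int.le_floor.2 ?_
        push_cast
        nlinarith [hval.1]
      have hhi : c₁ ≤ 10 * 2 ^ n := by
        have : (c₁ : ℝ) ≤ 10 * 2 ^ n := by nlinarith [hval.2]
        exact_mod_cast this
      obtain ⟨b, hb⟩ : ∃ b : ℕ, (b : ℤ) = c₁ + 10 * 2 ^ n :=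
        ⟨(c₁ + 10 * 2 ^ n).toNat, Int.toNat_of_nonneg (by linarith)⟩
      have hb' : b < 20 * 2 ^ n + 1 := by
        zify
        linarith
      have hbr : (b : ℝ) = c₁ + 10 * 2 ^ n := by exact_mod_cast hb
      -- The floor `c₁` is itself a grid ordinate on or below the first line. Equal traces put it on
      -- or below the second line, whose floor is then at least `c₁`; the other inequality follows
      -- by symmetry.
      have hin : ((⟨j, hj⟩, ⟨b, hb'⟩) : α) ∈ P (p₁, v₁) i := by
        simp only [P, W, y, s, Finset.mem_filter, Finset.mem_univ, true_and, hbr]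
        linarith
      rw [hP] at hin
      simp only [P, W, y, s, Finset.mem_filter, Finset.mem_univ, true_and, hbr] at hin
      refine Int.le_floor.2 ?_
      linarith
    ext i
    exact le_antisymm (key _ _ _ _ hpv hPl.symm i) (key _ _ _ _ hl hPl i)

/-! ### Occupation times and refinement of cell paths -/

lemma cellPath_dominant {j₀ : Fin d} {p v : Fin d → ℝ} (h : IsGraphLine j₀ p v) (n : ℕ) {q : ℕ}
    (hq : 0 < q) (j : ℕ) : cellPath n (2 ^ n * q) p v j j₀ = ((j / q : ℕ) : ℤ) := by
  have hq' : (0 : ℝ) < q := by exact_mod_cast hq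
  have : (2 : ℝ) ^ n * (p j₀ + v j₀ * (j / ((2 ^ n * q : ℕ) : ℝ))) = (j : ℝ) / q := by
    rw [h.base, h.slope]
    push_cast
    field_simp
    ring
  rw [cellPath, this, ← Nat.floor_div_eq_div (K := ℝ) j q,
    ← Int.natCast_floor_eq_floor (by positivity)]

lemma card_filter_div_eq (M q c : ℕ) (hc : c < M) :
    ((Finset.range (M * q)).filter fun j => j / q = c).card = q := by
  rcases Nat.eq_zero_or_pos q with rfl | hq
  · simp
  have : (Finset.range (M * q)).filter (fun j => j / q = c) = Finset.Ico (c * q) (c * q + q) := by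
    ext j
    rw [Finset.mem_filter, Finset.mem_range, Finset.mem_Ico, Nat.div_eq_iff hq]
    have : (c + 1) * q ≤ M * q := Nat.mul_le_mul_right q hc
    rw [add_mul, one_mul] at this
    omega
  rw [this, Nat.card_Ico]
  omega

/-- The dominant coordinate moves at unit speed, so it alone limits the stay in a cell to `q` of the
`2 ^ n * q` samples. -/
lemma card_filter_cellPath_le {j₀ : Fin d} {p v : Fin d → ℝ} (h : IsGraphLine j₀ p v) (n : ℕ)
    {q : ℕ} (hq : 0 < q) (k : Fin d → ℤ) :
    ((Finset.range (2 ^ n * q)).filter fun j => cellPath n (2 ^ n * q) p v j = k).card ≤ q := by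
  by_cases hk : ∃ c : ℕ, c < 2 ^ n ∧ k j₀ = c
  · obtain ⟨c, hc, hkc⟩ := hk
    refine (Finset.card_le_card fun j hj => ?_).trans (card_filter_div_eq (2 ^ n) q c hc).le
    rw [Finset.mem_filter] at hj ⊢
    refine ⟨hj.1, ?_⟩
    have := congrFun hj.2 j₀
    rw [cellPath_dominant h n hq, hkc] at this
    exact_mod_cast this
  · rw [Finset.filter_false_of_mem]
    · simp
    · intro j hj e
      refine hk ⟨j / q, ?_, ?_⟩
      · rw [Finset.mem_range] at hj
        exact (Nat.div_lt_iff_lt_mul hq).2 hj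
      · rw [← e, cellPath_dominant h n hq]

lemma cellPath_succ_div (n m : ℕ) (p v : Fin d → ℝ) (j : ℕ) (i : Fin d) :
    cellPath (n + 1) m p v j i / 2 = cellPath n m p v j i := by
  simp only [cellPath]
  have := Int.floor_div_natCast (2 ^ (n + 1) * (p i + v i * (j / m : ℝ))) 2
  push_cast at this
  rw [← this, pow_succ]
  congr 1
  ring

lemma sum_range_mul_eq (G : ℕ → ℝ) (m q : ℕ) :
    ∑ j ∈ Finset.range (m * q), G j
      = ∑ j ∈ Finset.range m, ∑ l ∈ Finset.range q, G (j * q + l) := by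
  induction m with
  | zero => simp
  | succ m ih => rw [add_mul, one_mul, Finset.sum_range_add, ih, Finset.sum_range_succ]

/-- The floors are monotone in `j`, so their total variation telescopes to the difference of the end
values. -/
lemma sum_abs_floor_sub_le (p v : ℝ) (m : ℕ) :
    ∑ j ∈ Finset.range m, |((⌊p + v * ((j + 1 : ℕ) / m : ℝ)⌋ - ⌊p + v * (j / m : ℝ)⌋ : ℤ) : ℝ)|
      ≤ |v| + 1 := by
  have key : ∀ u : ℕ → ℝ, (Monotone u ∨ Antitone u) →
      ∑ j ∈ Finset.range m, |u (j + 1) - u j| = |u m - u 0| := by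
    rintro u (hu | hu)
    · rw [abs_of_nonneg (sub_nonneg.2 (hu (Nat.zero_le m))), ← Finset.sum_range_sub]
      exact Finset.sum_congr rfl fun j _ => abs_of_nonneg (sub_nonneg.2 (hu (Nat.le_succ j)))
    · rw [abs_of_nonpos (sub_nonpos.2 (hu (Nat.zero_le m))), ← Finset.sum_range_sub,
        ← Finset.sum_neg_distrib]
      exact Finset.sum_congr rfl fun j _ => abs_of_nonpos (sub_nonpos.2 (hu (Nat.le_succ j)))
  have hmono : Monotone (fun j : ℕ => ((⌊p + v * (j / m : ℝ)⌋ : ℤ) : ℝ)) ∨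
      Antitone (fun j : ℕ => ((⌊p + v * (j / m : ℝ)⌋ : ℤ) : ℝ)) := by
    have hd : ∀ a b : ℕ, a ≤ b → (a / m : ℝ) ≤ b / m := fun a b hab => by gcongr
    rcases le_total 0 v with hv | hv
    · refine Or.inl fun a b hab => ?_
      exact Int.cast_le.2 (Int.floor_le_floor (by nlinarith [hd a b hab]))
    · refine Or.inr fun a b hab => ?_
      exact Int.cast_le.2 (Int.floor_le_floor (by nlinarith [hd a b hab]))
  have h := key _ hmono
  push_cast at h ⊢
  rw [h]
  -- `m / m` is not replaced by 1 because `m = 0` is allowed.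
  have hm : |v * (m / m : ℝ)| ≤ |v| := by
    rw [abs_mul]
    refine mul_le_of_le_one_right (abs_nonneg _) ?_
    rw [abs_of_nonneg (by positivity)]
    exact div_self_le_one _
  rw [abs_le] at hm ⊢
  have a1 := Int.floor_le (p + v * (m / m : ℝ))
  have a2 := Int.lt_floor_add_one (p + v * (m / m : ℝ))
  have a3 := Int.floor_le (p + v * (0 / m : ℝ))
  have a4 := Int.lt_floor_add_one (p + v * (0 / m : ℝ))
  simp only [zero_div, mul_zero, add_zero] at a3 a4 ⊢
  constructor <;> linarith [hm.1, hm.2]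

/-- Refining the sampling of a line changes the sampled sums by little, since every coordinate
of the cell path is monotone. -/
lemma sum_cellPath_refine_le {p v : Fin d → ℝ} (hv : ∀ i, |v i| ≤ 1) (n : ℕ) {m q : ℕ}
    (hm : 0 < m) (hq : 0 < q) (g : (Fin d → ℤ) → ℝ) {D : ℝ} (hg0 : ∀ k, 0 ≤ g k)
    (hgD : ∀ k, g k ≤ D) :
    ∑ j ∈ Finset.range (m * q), g (cellPath n (m * q) p v j)
      ≤ q * ∑ j ∈ Finset.range m, g (cellPath n m p v j) + q * (D * (d * (2 ^ n + 1))) := by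
  have hD : 0 ≤ D := (hg0 0).trans (hgD 0)
  let u : Fin d → ℕ → ℤ := fun i j => cellPath n m p v j i
  have hmr : (0 : ℝ) < m := by exact_mod_cast hm
  have hqr : (0 : ℝ) < q := by exact_mod_cast hq
  -- If no coordinate changes its cell between the coarse samples `j` and `j + 1`, all fine samples
  -- in between share the cell. Otherwise the block costs at most `q * D`, which is charged to the
  -- variation of the changing coordinate.
  have hblock : ∀ j, ∑ l ∈ Finset.range q, g (cellPath n (m * q) p v (j * q + l))
      ≤ q * (g (cellPath n m p v j) + D * ∑ i, |((u i (j + 1) - u i j : ℤ) : ℝ)|) := by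
    intro j
    rw [← nsmul_eq_mul, ← Finset.card_range q, ← Finset.sum_const, Finset.card_range]
    refine Finset.sum_le_sum fun l hl => ?_
    by_cases hall : ∀ i, u i (j + 1) = u i j
    · have : cellPath n (m * q) p v (j * q + l) = cellPath n m p v j := by
        ext i
        have hlq : (l : ℝ) ≤ q := by exact_mod_cast (Finset.mem_range.1 hl).le
        have t1 : (j / m : ℝ) ≤ ((j * q + l : ℕ) : ℝ) / ((m * q : ℕ) : ℝ) := by
          push_cast
          rw [div_le_div_iff₀ hmr (by positivity)]
          have : (0 : ℝ) ≤ l * m := by positivity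
          nlinarith
        have t2 : ((j * q + l : ℕ) : ℝ) / ((m * q : ℕ) : ℝ) ≤ ((j + 1 : ℕ) / m : ℝ) := by
          push_cast
          rw [div_le_div_iff₀ (by positivity) hmr]
          nlinarith [mul_le_mul_of_nonneg_right hlq hmr.le]
        have h2n : (0 : ℝ) < 2 ^ n := by positivity
        have hi := hall i
        simp only [u, cellPath] at hi ⊢
        rcases le_total 0 (v i) with h0 | h0
        · refine le_antisymm ?_ ?_
          · rw [← hi]
            exact Int.floor_le_floor (by gcongr)
          · exact Int.floor_le_floor (by gcongr)
        · refine le_antisymm ?_ ?_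
          · refine Int.floor_le_floor (mul_le_mul_of_nonneg_left ?_ h2n.le)
            linarith [mul_le_mul_of_nonpos_left t1 h0]
          · rw [← hi]
            refine Int.floor_le_floor (mul_le_mul_of_nonneg_left ?_ h2n.le)
            linarith [mul_le_mul_of_nonpos_left t2 h0]
      rw [this]
      have : 0 ≤ D * ∑ i, |((u i (j + 1) - u i j : ℤ) : ℝ)| :=
        mul_nonneg hD (Finset.sum_nonneg fun i _ => abs_nonneg _)
      linarith
    · push Not at hall
      obtain ⟨i, hi⟩ := hall
      have h1 : (1 : ℝ) ≤ |((u i (j + 1) - u i j : ℤ) : ℝ)| := by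
        rw [← Int.cast_abs]
        exact_mod_cast Int.one_le_abs (sub_ne_zero.2 hi)
      have h2 : (1 : ℝ) ≤ ∑ i, |((u i (j + 1) - u i j : ℤ) : ℝ)| :=
        h1.trans (Finset.single_le_sum (f := fun i => |((u i (j + 1) - u i j : ℤ) : ℝ)|)
          (fun i _ => abs_nonneg _) (Finset.mem_univ i))
      have h3 := mul_le_mul_of_nonneg_left h2 hD
      linarith [hgD (cellPath n (m * q) p v (j * q + l)), hg0 (cellPath n m p v j)]
  rw [sum_range_mul_eq]
  refine (Finset.sum_le_sum fun j _ => hblock j).trans ?_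
  rw [← Finset.mul_sum, Finset.sum_add_distrib, mul_add, ← Finset.mul_sum, Finset.sum_comm]
  gcongr
  refine (Finset.sum_le_card_nsmul Finset.univ _ (2 ^ n + 1) fun i _ => ?_).trans (by simp [mul_add])
  have h := sum_abs_floor_sub_le (2 ^ n * p i) (2 ^ n * v i) m
  have e : ∀ x : ℝ, 2 ^ n * p i + 2 ^ n * v i * x = 2 ^ n * (p i + v i * x) := fun x => by ring
  simp only [e] at h
  refine h.trans ?_
  rw [abs_mul, abs_of_pos (by positivity : (0 : ℝ) < 2 ^ n)]
  have h2n : (0 : ℝ) < 2 ^ n := by positivity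
  nlinarith [hv i]

/-! ### Sampled integrals of the natural densities and their random increments -/

/-- The number of sample times `j < m` at which the cell path `f` is in the cube `k`. -/
def hits (f : ℕ → Fin d → ℤ) (m : ℕ) (k : Fin d → ℕ) : ℕ :=
  ((Finset.range m).filter fun j => f j = fun i => (k i : ℤ)).card

/-- The cell path one level up. -/
def halfPath (f : ℕ → Fin d → ℤ) : ℕ → Fin d → ℤ := fun j i => f j i / 2

/-- This identity is what makes the increment over a uniformly chosen child centred. -/
lemma hits_halfPath (f : ℕ → Fin d → ℤ) (m : ℕ) (κ : Fin d → ℕ) :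
    hits (halfPath f) m κ = ∑ e, hits f m (child κ e) := by
  classical
  let g : ℕ → Fin d → Fin 2 := fun j i => if f j i % 2 = 0 then 0 else 1
  rw [hits, Finset.card_eq_sum_card_fiberwise (f := g) (t := Finset.univ) fun _ _ => by simp]
  refine Finset.sum_congr rfl fun e _ => ?_
  rw [hits, Finset.filter_filter]
  congr 1
  refine Finset.filter_congr fun j _ => ?_
  constructor
  · rintro ⟨h1, h2⟩
    ext i
    have h1 := congrFun h1 i
    have h2 := congrFun h2 i
    simp only [halfPath, g, child] at h1 h2 ⊢
    split_ifs at h2 with h <;> rw [← h2] <;> push_cast <;> simp <;> omega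
  · intro h
    have hi : ∀ i, f j i = 2 * (κ i : ℤ) + ((e i : ℕ) : ℤ) := fun i => by
      rw [h]; simp [child]
    constructor
    · ext i
      have := (e i).isLt
      simp only [halfPath, hi]
      omega
    · ext i
      simp only [g, hi]
      have := (e i).isLt
      split_ifs with h' <;> simp <;> omega

lemma hits_child_le (f : ℕ → Fin d → ℤ) (m : ℕ) (κ : Fin d → ℕ) (e : Fin d → Fin 2) :
    hits f m (child κ e) ≤ hits (halfPath f) m κ := by
  rw [hits_halfPath]
  exact Finset.single_le_sum (f := fun e => hits f m (child κ e)) (fun _ _ => Nat.zero_le _)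
    (Finset.mem_univ e)

/-- The density of the natural measure on the surviving cubes of level `n`. -/
noncomputable def dens (d : ℕ) (a : ℕ → ℕ) (n : ℕ) : ℝ := 2 ^ (d * n) / pop a n

/-- The average over `m` sample times of the density of level `n` along the cell path `f`. -/
noncomputable def pathAverage (a : ℕ → ℕ) (ω : Choices d) (n m : ℕ) (f : ℕ → Fin d → ℤ) : ℝ :=
  dens d a n / m * ∑ k ∈ surv a ω n, (hits f m k : ℝ)

lemma dens_nonneg (a : ℕ → ℕ) (n : ℕ) : 0 ≤ dens d a n := by
  unfold dens
  positivity

lemma dens_succ_of_eq_one {n : ℕ} (h : a n = 1) : dens d a (n + 1) = 2 ^ d * dens d a n := by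
  rw [dens, dens, pop_succ, h, mul_add, pow_add]
  simp
  ring

lemma dens_succ_of_eq_two_pow {n : ℕ} (h : a n = 2 ^ d) : dens d a (n + 1) = dens d a n := by
  rw [dens, dens, pop_succ, h, mul_add, pow_add, mul_one]
  push_cast
  exact mul_div_mul_right _ _ (by positivity)

lemma pathAverage_succ_of_eq_one {n : ℕ} (h : a n = 1) (m : ℕ) (f : ℕ → Fin d → ℤ) :
    pathAverage a ω (n + 1) m f = dens d a n / m *
      ∑ κ ∈ surv a ω n, (2 : ℝ) ^ d * hits f m (child κ (ω (n, κ))) := by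
  rw [pathAverage, dens_succ_of_eq_one h, surv_succ_of_eq_one h, Finset.sum_image,
    ← Finset.mul_sum]
  · ring
  · intro κ _ κ' _ e
    have := congrArg (ancestor 1) e
    simpa only [ancestor_one_child] using this

lemma pathAverage_succ_of_ne_one {n : ℕ} (h1 : a n ≠ 1) (h : a n = 2 ^ d) (m : ℕ)
    (f : ℕ → Fin d → ℤ) :
    pathAverage a ω (n + 1) m f = pathAverage a ω n m (halfPath f) := by
  rw [pathAverage, pathAverage, dens_succ_of_eq_two_pow h]
  congr 1
  have hmap : ∀ k ∈ surv a ω (n + 1), ancestor 1 k ∈ surv a ω n := fun k hk =>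
    (mem_surv_succ.1 hk).1
  rw [← Finset.sum_fiberwise_of_maps_to hmap]
  refine Finset.sum_congr rfl fun κ hκ => ?_
  have : (surv a ω (n + 1)).filter (fun k => ancestor 1 k = κ) = Finset.univ.image (child κ) := by
    ext k
    rw [Finset.mem_filter, Finset.mem_image]
    constructor
    · rintro ⟨_, h⟩
      obtain ⟨e, rfl⟩ := exists_eq_child h
      exact ⟨e, Finset.mem_univ _, rfl⟩
    · rintro ⟨e, _, rfl⟩
      exact ⟨child_mem_surv.2 ⟨hκ, fun h => absurd h h1⟩, ancestor_one_child _ _⟩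
  rw [this, Finset.sum_image fun _ _ _ _ e => child_injective κ e, hits_halfPath]
  push_cast
  rfl

/-! ### Independence of the choices and Hoeffding's inequality for one step -/

instance (d : ℕ) : IsProbabilityMeasure (choiceMeasure d) := by
  unfold choiceMeasure
  infer_instance

lemma map_eval_choiceMeasure (i : ℕ × (Fin d → ℕ)) :
    (choiceMeasure d).map (fun ω => ω i) = (PMF.uniformOfFintype (Fin d → Fin 2)).toMeasure :=
  Measure.infinitePi_map_eval (fun _ : ℕ × (Fin d → ℕ) =>
    (PMF.uniformOfFintype (Fin d → Fin 2)).toMeasure) i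

lemma iIndepFun_choices {β : ℕ × (Fin d → ℕ) → Type*} {mβ : ∀ i, MeasurableSpace (β i)}
    (X : (i : ℕ × (Fin d → ℕ)) → (Fin d → Fin 2) → β i) :
    ProbabilityTheory.iIndepFun (fun i (ω : Choices d) => X i (ω i)) (choiceMeasure d) :=
  ProbabilityTheory.iIndepFun_infinitePi (P := fun _ : ℕ × (Fin d → ℕ) =>
    (PMF.uniformOfFintype (Fin d → Fin 2)).toMeasure) fun _ => measurable_of_countable _

lemma hasSubgaussianMGF_choice (i : ℕ × (Fin d → ℕ)) (Z : (Fin d → Fin 2) → ℝ) {l u : ℝ}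
    (hZ : ∀ e, Z e ∈ Icc l u) (h0 : ∑ e, Z e = 0) :
    ProbabilityTheory.HasSubgaussianMGF (fun ω : Choices d => Z (ω i)) ((‖u - l‖₊ / 2) ^ 2)
      (choiceMeasure d) := by
  have hm : Measurable fun ω : Choices d => ω i := measurable_pi_apply i
  have hZm : Measurable Z := measurable_of_countable _
  refine ProbabilityTheory.hasSubgaussianMGF_of_mem_Icc_of_integral_eq_zero
    (hZm.comp hm).aemeasurable (ae_of_all _ fun ω => hZ _) ?_
  have h := integral_map (μ := choiceMeasure d) hm.aemeasurable
    (f := Z) hZm.aestronglyMeasurable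
  rw [← h, map_eval_choiceMeasure, PMF.integral_eq_sum]
  simp only [PMF.uniformOfFintype_apply, smul_eq_mul]
  rw [← Finset.mul_sum, h0, mul_zero]

/-- Hoeffding's inequality for the increment of a path average, for a fixed set of cubes. -/
lemma measure_increment_le (n m : ℕ) (f : ℕ → Fin d → ℤ) (S : Finset (Fin d → ℕ)) {c H ε : ℝ}
    (hc : 0 < c) (hε : 0 < ε) (hH : ∀ κ, (hits (halfPath f) m κ : ℝ) ≤ H) :
    (choiceMeasure d) {ω | ε * max 1 (c * ∑ κ ∈ S, (hits (halfPath f) m κ : ℝ)) ≤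
      ∑ κ ∈ S, c * (2 ^ d * hits f m (child κ (ω (n, κ))) - hits (halfPath f) m κ)}
      ≤ ENNReal.ofReal (Real.exp (-(2 * ε ^ 2 / (4 ^ d * (c * H))))) := by
  set h : (Fin d → ℕ) → ℝ := fun κ => (hits (halfPath f) m κ : ℝ) with hh
  have hh0 : ∀ κ, 0 ≤ h κ := fun κ => by positivity
  set y := c * ∑ κ ∈ S, h κ with hy
  have hy0 : 0 ≤ y := mul_nonneg hc.le (Finset.sum_nonneg fun κ _ => hh0 κ)
  let Z : (Fin d → ℕ) → (Fin d → Fin 2) → ℝ := fun κ e =>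
    c * (2 ^ d * hits f m (child κ e) - h κ)
  have ht : 0 < ε * max 1 y := mul_pos hε (lt_max_of_lt_left one_pos)
  have h2d : (0 : ℝ) < 2 ^ d := by positivity
  -- If the path visits no cube of `S`, the sum vanishes and the event is empty. In the other case
  -- the variance proxy in the denominator is positive.
  rcases hy0.eq_or_lt with hy0 | hypos
  · have hz : ∀ κ ∈ S, h κ = 0 := by
      have := (mul_eq_zero.1 hy0.symm).resolve_left hc.ne'
      exact (Finset.sum_eq_zero_iff_of_nonneg fun κ _ => hh0 κ).1 this
    have he : {ω : Choices d | ε * max 1 y ≤ ∑ κ ∈ S, Z κ (ω (n, κ))} = ∅ := by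
      ext ω
      simp only [mem_ofPred_eq, mem_empty_iff_false, iff_false, not_le]
      refine lt_of_eq_of_lt (Finset.sum_eq_zero fun κ hκ => ?_) ht
      have h1 : (hits f m (child κ (ω (n, κ))) : ℝ) ≤ h κ := by
        exact Nat.cast_le.2 (hits_child_le f m κ _)
      have h2 : (hits f m (child κ (ω (n, κ))) : ℝ) = 0 :=
        le_antisymm (h1.trans (hz κ hκ).le) (by positivity)
      simp only [Z, h2, hz κ hκ]
      ring
    change (choiceMeasure d) {ω : Choices d | ε * max 1 y ≤ ∑ κ ∈ S, Z κ (ω (n, κ))} ≤ _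
    rw [he, measure_empty]
    exact zero_le
  have hHpos : 0 < H := by
    obtain ⟨κ, hκ, hpos⟩ : ∃ κ ∈ S, 0 < h κ := by
      by_contra! hcon
      have : ∑ κ ∈ S, h κ ≤ 0 := Finset.sum_nonpos hcon
      nlinarith
    exact hpos.trans_le (hH κ)
  have hsub : ∀ κ ∈ S, ProbabilityTheory.HasSubgaussianMGF (fun ω : Choices d => Z κ (ω (n, κ)))
      ((‖c * (2 ^ d - 1) * h κ - (-(c * h κ))‖₊ / 2) ^ 2) (choiceMeasure d) := by
    intro κ _
    refine hasSubgaussianMGF_choice (n, κ) (Z κ) (fun e => ?_) ?_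
    · have h1 : (hits f m (child κ e) : ℝ) ≤ h κ :=
        Nat.cast_le.2 (hits_child_le f m κ e)
      have h0 : (0 : ℝ) ≤ hits f m (child κ e) := by positivity
      constructor
      · have : 0 ≤ c * (2 ^ d * (hits f m (child κ e) : ℝ)) := by positivity
        simp only [Z]
        linarith
      · have : c * (2 ^ d * (hits f m (child κ e) : ℝ)) ≤ c * (2 ^ d * h κ) := by gcongr
        simp only [Z]
        linarith
    · simp only [Z]
      rw [← Finset.mul_sum, Finset.sum_sub_distrib, ← Finset.mul_sum, Finset.sum_const]
      have : (∑ e, (hits f m (child κ e) : ℝ)) = h κ := by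
        rw [hh]
        simp only [hits_halfPath]
        push_cast
        rfl
      rw [this]
      simp
  have hind : ProbabilityTheory.iIndepFun
      (fun (κ : Fin d → ℕ) (ω : Choices d) => Z κ (ω (n, κ))) (choiceMeasure d) :=
    (iIndepFun_choices (β := fun _ => ℝ) fun i => Z i.2).precomp (g := fun κ => (n, κ))
      (Prod.mk_right_injective n)
  have hHoeff := ProbabilityTheory.HasSubgaussianMGF.measure_sum_ge_le_of_iIndepFun hind hsub ht.le
  rw [ENNReal.le_ofReal_iff_toReal_le (measure_ne_top _ _) (Real.exp_pos _).le]
  refine hHoeff.trans (Real.exp_le_exp.2 ?_)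
  -- The summand of `κ` ranges over an interval of length c 2^d h(κ), and h(κ)² ≤ H h(κ); so the
  -- total variance proxy is linear in the current average `y`.
  have hsum : ((∑ κ ∈ S, (‖c * (2 ^ d - 1) * h κ - (-(c * h κ))‖₊ / 2) ^ 2 : NNReal) : ℝ)
      ≤ 4 ^ d / 4 * (c * H) * y := by
    push_cast
    rw [hy, Finset.mul_sum, Finset.mul_sum]
    refine Finset.sum_le_sum fun κ _ => ?_
    have e1 : c * (2 ^ d - 1) * h κ - (-(c * h κ)) = c * 2 ^ d * h κ := by ring
    have e2 : (4 : ℝ) ^ d = 2 ^ d * 2 ^ d := by rw [← mul_pow]; norm_num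
    rw [e1, Real.norm_of_nonneg (mul_nonneg (by positivity) (hh0 κ)), e2]
    have : h κ * h κ ≤ H * h κ := mul_le_mul_of_nonneg_right (hH κ) (hh0 κ)
    have h3 : 0 ≤ (c * 2 ^ d) ^ 2 / 4 := by positivity
    nlinarith [mul_le_mul_of_nonneg_left this h3]
  have hspos : 0 < ((∑ κ ∈ S, (‖c * (2 ^ d - 1) * h κ - (-(c * h κ))‖₊ / 2) ^ 2 : NNReal) : ℝ) := by
    obtain ⟨κ, hκ, hpos⟩ : ∃ κ ∈ S, 0 < h κ := by
      by_contra! hcon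
      have : ∑ κ ∈ S, h κ ≤ 0 := Finset.sum_nonpos hcon
      nlinarith
    push_cast
    refine Finset.sum_pos' (fun _ _ => by positivity) ⟨κ, hκ, ?_⟩
    have e1 : c * (2 ^ d - 1) * h κ - (-(c * h κ)) = c * 2 ^ d * h κ := by ring
    rw [e1]
    have : 0 < ‖c * 2 ^ d * h κ‖ := norm_pos_iff.2 (by positivity)
    positivity
  rw [neg_div, neg_le_neg_iff, div_le_div_iff₀ (by positivity) (by positivity)]
  -- The threshold ε max(1, y) is designed for this: its square absorbs the factor `y` of the
  -- variance, and the tail bound no longer depends on `S`.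
  have hmax : y ≤ max 1 y ^ 2 := by
    have h1 := le_max_left 1 y
    have h2 := le_max_right 1 y
    nlinarith
  have hA : 0 ≤ ε ^ 2 * (4 ^ d * (c * H)) := by positivity
  calc 2 * ε ^ 2 * (2 * ((∑ κ ∈ S, (‖c * (2 ^ d - 1) * h κ - (-(c * h κ))‖₊ / 2) ^ 2 : NNReal) : ℝ))
      ≤ 2 * ε ^ 2 * (2 * (4 ^ d / 4 * (c * H) * y)) := by gcongr
    _ = ε ^ 2 * (4 ^ d * (c * H)) * y := by ring
    _ ≤ ε ^ 2 * (4 ^ d * (c * H)) * max 1 y ^ 2 := mul_le_mul_of_nonneg_left hmax hA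
    _ = _ := by ring

/-- The indices of the choices that determine the survivors of level `n`. -/
def levelsBelow (d n : ℕ) : Finset (ℕ × (Fin d → ℕ)) :=
  Finset.range n ×ˢ Fintype.piFinset fun _ => Finset.range (2 ^ n)

lemma levelsBelow_subset_succ (n : ℕ) : levelsBelow d n ⊆ levelsBelow d (n + 1) := by
  refine Finset.product_subset_product (Finset.range_mono n.le_succ)
    (Fintype.piFinset_subset _ _ fun _ => Finset.range_mono ?_)
  exact Nat.pow_le_pow_right two_pos n.le_succ

/-- Makes the events `surv a ω n = S` measurable and independent of the choices at level `n`. -/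
lemma surv_congr {ω ω' : Choices d} (n : ℕ) (h : ∀ i ∈ levelsBelow d n, ω i = ω' i) :
    surv a ω n = surv a ω' n := by
  induction n with
  | zero => rw [surv_zero, surv_zero]
  | succ n ih =>
    have ih := ih fun i hi => h i (levelsBelow_subset_succ n hi)
    ext k
    rw [mem_surv_succ, mem_surv_succ, ih]
    refine and_congr_right fun hk => ?_
    have : ω (n, ancestor 1 k) = ω' (n, ancestor 1 k) := by
      refine h _ (Finset.mem_product.2 ⟨by simp, Fintype.mem_piFinset.2 fun i => ?_⟩)
      have := survivors_lt n _ (mem_surv.1 hk) i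
      rw [Finset.mem_range]
      exact this.trans (Nat.pow_lt_pow_right one_lt_two n.lt_succ_self)
    rw [this]

/-- The conditional form of Hoeffding's inequality for the increment of a path average. -/
lemma measure_pathAverage_succ_le (ha : ∀ n, a n = 1 ∨ a n = 2 ^ d) (n m : ℕ) (hm : 0 < m)
    (f : ℕ → Fin d → ℤ) {H ε : ℝ} (hε : 0 < ε)
    (hH : ∀ κ, (hits (halfPath f) m κ : ℝ) ≤ H) :
    (choiceMeasure d) {ω | pathAverage a ω n m (halfPath f)
        + ε * max 1 (pathAverage a ω n m (halfPath f)) ≤ pathAverage a ω (n + 1) m f}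
      ≤ ENNReal.ofReal (Real.exp (-(2 * ε ^ 2 / (4 ^ d * (dens d a n / m * H))))) := by
  classical
  set b := ENNReal.ofReal (Real.exp (-(2 * ε ^ 2 / (4 ^ d * (dens d a n / m * H))))) with hb
  by_cases h1 : a n = 1
  swap
  · have h2 := (ha n).resolve_left h1
    have he : {ω : Choices d | pathAverage a ω n m (halfPath f)
        + ε * max 1 (pathAverage a ω n m (halfPath f)) ≤ pathAverage a ω (n + 1) m f} = ∅ := by
      ext ω
      simp only [mem_ofPred_eq, mem_empty_iff_false, iff_false, not_le]
      rw [pathAverage_succ_of_ne_one h1 h2]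
      exact lt_add_of_pos_right _ (mul_pos hε (lt_max_of_lt_left one_pos))
    rw [he, measure_empty]
    exact zero_le
  set c := dens d a n / m with hc
  have hcpos : 0 < c := by
    have : (0 : ℝ) < pop a n := by exact_mod_cast pop_pos ha n
    have : (0 : ℝ) < m := by exact_mod_cast hm
    rw [hc, dens]
    positivity
  -- Conditioning is done by hand: the event is split according to the value of `surv a ω n`, which
  -- takes finitely many values.
  let 𝒮 : Finset (Finset (Fin d → ℕ)) := (Fintype.piFinset fun _ => Finset.range (2 ^ n)).powerset
  let A : Finset (Fin d → ℕ) → Set (Choices d) := fun S => {ω | surv a ω n = S}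
  let B : Finset (Fin d → ℕ) → Set (Choices d) := fun S =>
    {ω | ε * max 1 (c * ∑ κ ∈ S, (hits (halfPath f) m κ : ℝ)) ≤
      ∑ κ ∈ S, c * (2 ^ d * hits f m (child κ (ω (n, κ))) - hits (halfPath f) m κ)}
  have hsub : {ω : Choices d | pathAverage a ω n m (halfPath f)
        + ε * max 1 (pathAverage a ω n m (halfPath f)) ≤ pathAverage a ω (n + 1) m f}
      ⊆ ⋃ S ∈ 𝒮, A S ∩ B S := by
    intro ω hω
    refine mem_iUnion₂.2 ⟨surv a ω n, ?_, rfl, ?_⟩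
    · refine Finset.mem_powerset.2 fun k hk => Fintype.mem_piFinset.2 fun i => ?_
      exact Finset.mem_range.2 (survivors_lt n k (mem_surv.1 hk) i)
    · have hω : pathAverage a ω n m (halfPath f)
        + ε * max 1 (pathAverage a ω n m (halfPath f)) ≤ pathAverage a ω (n + 1) m f := hω
      rw [pathAverage_succ_of_eq_one h1, pathAverage, ← hc] at hω
      change ε * max 1 (c * ∑ κ ∈ surv a ω n, (hits (halfPath f) m κ : ℝ)) ≤ ∑ κ ∈ surv a ω n,
        c * (2 ^ d * (hits f m (child κ (ω (n, κ))) : ℝ) - hits (halfPath f) m κ)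
      rw [← Finset.mul_sum, Finset.sum_sub_distrib, mul_sub]
      linarith
  -- The restriction has a finite range, so every set of outcomes that it determines is measurable.
  let R : Choices d → (levelsBelow d n → Fin d → Fin 2) := fun ω i => ω i
  have hR : Measurable R := measurable_pi_lambda _ fun i => measurable_pi_apply _
  have hAR : ∀ S, A S = R ⁻¹' (R '' A S) := by
    intro S
    refine subset_antisymm (subset_preimage_image _ _) ?_
    rintro ω ⟨ω', hω', he⟩
    have : surv a ω' n = surv a ω n := surv_congr n fun i hi => congrFun he ⟨i, hi⟩
    exact this.symm.trans hω'
  have hAm : ∀ S, MeasurableSet (A S) := fun S => by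
    rw [hAR S]
    exact hR (Set.toFinite _).measurableSet
  have hind : ∀ S, (choiceMeasure d) (A S ∩ B S)
      = (choiceMeasure d) (A S) * (choiceMeasure d) (B S) := by
    intro S
    let J : Finset (ℕ × (Fin d → ℕ)) := S.image fun κ => (n, κ)
    let R' : Choices d → (J → Fin d → Fin 2) := fun ω i => ω i
    have hdisj : Disjoint (levelsBelow d n) J := by
      rw [Finset.disjoint_left]
      intro i hi hiJ
      obtain ⟨κ, _, rfl⟩ := Finset.mem_image.1 hiJ
      simpa using (Finset.mem_product.1 hi).1
    have hBR : B S = R' ⁻¹' (R' '' B S) := by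
      refine subset_antisymm (subset_preimage_image _ _) ?_
      rintro ω ⟨ω', hω', he⟩
      have hag : ∀ κ ∈ S, ω' (n, κ) = ω (n, κ) := fun κ hκ =>
        congrFun he ⟨(n, κ), Finset.mem_image_of_mem _ hκ⟩
      have : ∑ κ ∈ S, c * (2 ^ d * (hits f m (child κ (ω' (n, κ))) : ℝ) - hits (halfPath f) m κ)
          = ∑ κ ∈ S, c * (2 ^ d * (hits f m (child κ (ω (n, κ))) : ℝ) - hits (halfPath f) m κ) :=
        Finset.sum_congr rfl fun κ hκ => by rw [hag κ hκ]
      exact (show _ ≤ _ from hω').trans_eq this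
    have hi : ProbabilityTheory.IndepFun R R' (choiceMeasure d) :=
      (iIndepFun_choices (β := fun _ => Fin d → Fin 2) fun _ e => e).indepFun_finset
        (levelsBelow d n) J hdisj fun i => measurable_pi_apply i
    rw [hAR S, hBR]
    exact hi.measure_inter_preimage_eq_mul _ _ (Set.toFinite _).measurableSet
      (Set.toFinite _).measurableSet
  calc _ ≤ (choiceMeasure d) (⋃ S ∈ 𝒮, A S ∩ B S) := measure_mono hsub
    _ ≤ ∑ S ∈ 𝒮, (choiceMeasure d) (A S ∩ B S) := measure_biUnion_finset_le _ _
    _ ≤ ∑ S ∈ 𝒮, (choiceMeasure d) (A S) * b := by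
        refine Finset.sum_le_sum fun S _ => ?_
        rw [hind S]
        gcongr
        exact measure_increment_le n m f S hcpos hε hH
    _ = (choiceMeasure d) (⋃ S ∈ 𝒮, A S) * b := by
        rw [← Finset.sum_mul, measure_biUnion_finset _ fun S _ => hAm S]
        intro S _ S' _ hne
        refine Set.disjoint_left.2 fun ω h h' => hne ?_
        exact (show surv a ω n = S from h).symm.trans h'
    _ ≤ 1 * b := by gcongr; exact prob_le_one
    _ = b := one_mul b

/-! ### Almost sure boundedness along all lines -/

open Classical in
/-- The density of level `n` as a function of the (signed) dyadic cell. -/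
noncomputable def cellDensity (a : ℕ → ℕ) (ω : Choices d) (n : ℕ) (k : Fin d → ℤ) : ℝ :=
  if ∃ κ ∈ surv a ω n, k = fun i => (κ i : ℤ) then dens d a n else 0

lemma cellDensity_nonneg (n : ℕ) (k : Fin d → ℤ) : 0 ≤ cellDensity a ω n k := by
  unfold cellDensity
  split_ifs
  · exact dens_nonneg a n
  · exact le_rfl

lemma cellDensity_le (n : ℕ) (k : Fin d → ℤ) : cellDensity a ω n k ≤ dens d a n := by
  unfold cellDensity
  split_ifs
  · exact le_rfl
  · exact dens_nonneg a n

lemma cellDensity_eq_sum (n : ℕ) (k : Fin d → ℤ) :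
    cellDensity a ω n k
      = ∑ κ ∈ surv a ω n, if k = fun i => (κ i : ℤ) then dens d a n else 0 := by
  classical
  unfold cellDensity
  split_ifs with h
  · obtain ⟨κ, hκ, rfl⟩ := h
    rw [Finset.sum_eq_single_of_mem κ hκ, if_pos rfl]
    intro κ' _ hne
    refine if_neg fun e => hne ?_
    ext i
    exact_mod_cast (congrFun e i).symm
  · refine (Finset.sum_eq_zero fun κ hκ => if_neg fun e => h ⟨κ, hκ, e⟩).symm

/-- Summing over cubes suits independence; summing over times suits comparison of different
samplings. -/
lemma pathAverage_eq_sum (n m : ℕ) (f : ℕ → Fin d → ℤ) :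
    pathAverage a ω n m f = (∑ j ∈ Finset.range m, cellDensity a ω n (f j)) / m := by
  simp only [cellDensity_eq_sum]
  rw [Finset.sum_comm, pathAverage, div_mul_eq_mul_div, Finset.mul_sum]
  congr 1
  refine Finset.sum_congr rfl fun κ _ => ?_
  rw [← Finset.sum_filter, Finset.sum_const, nsmul_eq_mul, mul_comm]
  rfl

lemma pathAverage_congr {n m : ℕ} {f g : ℕ → Fin d → ℤ} (h : ∀ j < m, f j = g j) :
    pathAverage a ω n m f = pathAverage a ω n m g := by
  rw [pathAverage_eq_sum, pathAverage_eq_sum]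
  congr 1
  exact Finset.sum_congr rfl fun j hj => by rw [h j (Finset.mem_range.1 hj)]

lemma dens_le (ha : ∀ n, a n = 1 ∨ a n = 2 ^ d) (n : ℕ) : dens d a n ≤ 2 ^ (d * n) :=
  div_le_self (by positivity) (by exact_mod_cast pop_pos ha n)

lemma pathAverage_le (ha : ∀ n, a n = 1 ∨ a n = 2 ^ d) (n m : ℕ) (f : ℕ → Fin d → ℤ) :
    pathAverage a ω n m f ≤ 2 ^ (d * n) := by
  rw [pathAverage_eq_sum]
  refine div_le_of_le_mul₀ (by positivity) (by positivity) ?_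
  refine (Finset.sum_le_card_nsmul _ _ _ fun j _ => (cellDensity_le n (f j)).trans
    (dens_le ha n)).trans_eq ?_
  rw [Finset.card_range, nsmul_eq_mul, mul_comm]

/-- The number of sample times used at level `n`. -/
def samples (d n : ℕ) : ℕ := 2 ^ ((d + 2) * (n + 1))

lemma samples_pos (d n : ℕ) : 0 < samples d n := by unfold samples; positivity

lemma samples_succ (d n : ℕ) : samples d (n + 1) = samples d n * 2 ^ (d + 2) := by
  rw [samples, samples, ← pow_add]
  ring_nf

lemma exists_samples_eq {d n N : ℕ} (h : N ≤ n + 1) :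
    ∃ q, 0 < q ∧ samples d n = 2 ^ N * q := by
  refine ⟨2 ^ ((d + 2) * (n + 1) - N), by positivity, ?_⟩
  rw [← pow_add, samples]
  congr 1
  have : N ≤ (d + 2) * (n + 1) := h.trans (Nat.le_mul_of_pos_left _ (by omega))
  omega

/-- The average of the density of level `n` along the graph line `p + s v`. -/
noncomputable def lineAverage (a : ℕ → ℕ) (ω : Choices d) (n : ℕ) (p v : Fin d → ℝ) : ℝ :=
  pathAverage a ω n (samples d n) (cellPath n (samples d n) p v)

lemma halfPath_cellPath (n m : ℕ) (p v : Fin d → ℝ) :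
    halfPath (cellPath (n + 1) m p v) = cellPath n m p v := by
  ext j i
  exact cellPath_succ_div n m p v j i

lemma hits_cellPath_le {j₀ : Fin d} {p v : Fin d → ℝ} (h : IsGraphLine j₀ p v) (n : ℕ)
    (κ : Fin d → ℕ) : (hits (cellPath n (samples d n) p v) (samples d n) κ : ℝ)
      ≤ samples d n / 2 ^ n := by
  obtain ⟨q, hq, he⟩ := exists_samples_eq (d := d) (Nat.le_succ n)
  have h1 : ((samples d n : ℕ) : ℝ) / 2 ^ n = q := by
    rw [he]
    push_cast
    field_simp
  rw [h1, he]
  exact_mod_cast card_filter_cellPath_le h n hq _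

/-- The error comes only from refining the sample times. The exponent in `samples` makes it summable
even with the crude bound 2^(d(n+1)) for the density. -/
lemma lineAverage_succ_le (ha : ∀ n, a n = 1 ∨ a n = 2 ^ d) {j₀ : Fin d} {p v : Fin d → ℝ}
    (h : IsGraphLine j₀ p v) (n : ℕ) :
    lineAverage a ω (n + 1) p v
      ≤ pathAverage a ω (n + 1) (samples d n) (cellPath (n + 1) (samples d n) p v)
        + d * (1 / 2) ^ n := by
  have hm : (0 : ℝ) < samples d n := by exact_mod_cast samples_pos d n
  have hq : (0 : ℝ) < ((2 ^ (d + 2) : ℕ) : ℝ) := by positivity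
  have key := sum_cellPath_refine_le (p := p) h.slope_le (n + 1) (samples_pos d n)
    (Nat.pos_of_ne_zero (by positivity) : 0 < 2 ^ (d + 2)) (cellDensity a ω (n + 1))
    (cellDensity_nonneg _) fun k => (cellDensity_le _ k).trans (dens_le ha (n + 1))
  rw [lineAverage, pathAverage_eq_sum, pathAverage_eq_sum, samples_succ,
    div_le_iff₀ (by push_cast at hq ⊢; positivity)]
  refine key.trans ?_
  have e1 : (2 : ℝ) ^ (d * (n + 1)) * (d * (2 ^ (n + 1) + 1))
      ≤ d * (1 / 2) ^ n * samples d n := by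
    have e2 : ((samples d n : ℕ) : ℝ) = 2 ^ (d * (n + 1)) * (2 ^ (n + 1) * (2 * 2 ^ n)) := by
      rw [samples]
      push_cast
      rw [← pow_succ', ← pow_add, ← pow_add]
      congr 1
      ring
    have e3 : ((1 : ℝ) / 2) ^ n * 2 ^ n = 1 := by
      rw [← mul_pow]
      norm_num
    have e4 : (1 : ℝ) ≤ 2 ^ (n + 1) := one_le_pow₀ one_le_two
    calc (2 : ℝ) ^ (d * (n + 1)) * (d * (2 ^ (n + 1) + 1))
        ≤ 2 ^ (d * (n + 1)) * (d * (2 ^ (n + 1) + 2 ^ (n + 1))) := by gcongr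
      _ = d * (2 ^ (d * (n + 1)) * (2 ^ (n + 1) * 2)) * ((1 / 2) ^ n * 2 ^ n) := by
          rw [e3]; ring
      _ = d * (1 / 2) ^ n * samples d n := by rw [e2]; ring
  push_cast at hq ⊢
  have e5 := mul_le_mul_of_nonneg_left e1 hq.le
  have e6 : ∀ s x : ℝ, (s / samples d n + x) * (samples d n * 2 ^ (d + 2))
      = 2 ^ (d + 2) * s + 2 ^ (d + 2) * (x * samples d n) := fun s x => by
    field_simp
  rw [e6]
  linarith

/-- The allowed relative growth of the line averages from level `n` to level `n + 1`. -/
noncomputable def growth (d : ℕ) (a : ℕ → ℕ) (n : ℕ) : ℝ :=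
  √(4 ^ d / 2 * Real.log (2 ^ (2 * d * (d + 8) + 1)) * ((n + 1) * (dens d a n / 2 ^ n)))

/-- In `d + 8`, the sample times account for `d + 2`, the cell indices for 1 and the constant 32 =
2^5 for 5; the factor `2 * d` comes from the quadratic Sauer–Shelah bound in each of `d`
coordinates. -/
lemma card_graphLines_bound (d n : ℕ) :
    ((samples d n * (20 * 2 ^ (n + 1) + 1) + 1) ^ 2) ^ d ≤ (2 ^ (2 * d * (d + 8))) ^ (n + 1) := by
  have h1 : samples d n * (20 * 2 ^ (n + 1) + 1) + 1 ≤ 2 ^ ((d + 8) * (n + 1)) := by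
    have e1 : 1 ≤ samples d n := samples_pos d n
    have e2 : 1 ≤ 2 ^ (n + 1) := Nat.one_le_two_pow
    have e3 : 1 ≤ samples d n * 2 ^ (n + 1) := Nat.mul_pos e1 e2
    have e4 : 32 ≤ 2 ^ (5 * (n + 1)) := by
      calc 32 = 2 ^ (5 * 1) := by norm_num
        _ ≤ 2 ^ (5 * (n + 1)) := Nat.pow_le_pow_right two_pos (by omega)
    have e5 : samples d n ≤ samples d n * 2 ^ (n + 1) := Nat.le_mul_of_pos_right _ e2
    calc samples d n * (20 * 2 ^ (n + 1) + 1) + 1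
        = 20 * (samples d n * 2 ^ (n + 1)) + samples d n + 1 := by ring
      _ ≤ 32 * (samples d n * 2 ^ (n + 1)) := by omega
      _ ≤ 2 ^ (5 * (n + 1)) * (samples d n * 2 ^ (n + 1)) := Nat.mul_le_mul_right _ e4
      _ = 2 ^ ((d + 8) * (n + 1)) := by
        rw [samples, ← pow_add, ← pow_add]
        congr 1
        ring
  calc _ ≤ ((2 ^ ((d + 8) * (n + 1))) ^ 2) ^ d := by gcongr
    _ = _ := by
      rw [← pow_mul, ← pow_mul, ← pow_mul]
      congr 1
      ring

/-- Almost surely, from some level on, no line average grows by more than the allowed factor. -/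
lemma ae_eventually_growth (ha : ∀ n, a n = 1 ∨ a n = 2 ^ d) :
    ∀ᵐ ω ∂(choiceMeasure d), ∀ᶠ n in atTop, ∀ (j₀ : Fin d) (p v : Fin d → ℝ),
      IsGraphLine j₀ p v →
      pathAverage a ω (n + 1) (samples d n) (cellPath (n + 1) (samples d n) p v)
        ≤ lineAverage a ω n p v + growth d a n * max 1 (lineAverage a ω n p v) := by
  choose F hFcard hFmem hFrep using fun (n : ℕ) (j₀ : Fin d) =>
    exists_finset_graphLines j₀ (n + 1) (samples d n)
  set Λ : ℝ := Real.log (2 ^ (2 * d * (d + 8) + 1)) with hΛ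
  have hΛpos : 0 < Λ := Real.log_pos (one_lt_pow₀ one_lt_two (by omega))
  have hdens : ∀ n, 0 < dens d a n := fun n => by
    have : (0 : ℝ) < pop a n := by exact_mod_cast pop_pos ha n
    unfold dens
    positivity
  have hgpos : ∀ n, 0 < growth d a n := fun n => by
    have := hdens n
    exact Real.sqrt_pos.2 (by positivity)
  let bad : ℕ → Fin d → (Fin d → ℝ) × (Fin d → ℝ) → Set (Choices d) := fun n _ l =>
    {ω | pathAverage a ω n (samples d n) (halfPath (cellPath (n + 1) (samples d n) l.1 l.2))
        + growth d a n *
          max 1 (pathAverage a ω n (samples d n)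
            (halfPath (cellPath (n + 1) (samples d n) l.1 l.2)))
        ≤ pathAverage a ω (n + 1) (samples d n) (cellPath (n + 1) (samples d n) l.1 l.2)}
  have hbad : ∀ n j₀, ∀ l ∈ F n j₀, (choiceMeasure d) (bad n j₀ l)
      ≤ ENNReal.ofReal (((2 : ℝ) ^ (2 * d * (d + 8) + 1))⁻¹ ^ (n + 1)) := by
    intro n j₀ l hl
    refine (measure_pathAverage_succ_le ha n (samples d n) (samples_pos d n) _ (hgpos n)
      (H := samples d n / 2 ^ n) fun κ => ?_).trans ?_
    · rw [halfPath_cellPath]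
      exact hits_cellPath_le (hFmem n j₀ l hl) n κ
    · refine ENNReal.ofReal_le_ofReal (le_of_eq ?_)
      have hs : (0 : ℝ) < samples d n := by exact_mod_cast samples_pos d n
      have hd := hdens n
      -- `growth` is chosen to make the Hoeffding exponent `(n + 1) * Λ`. The surplus 1 in the
      -- exponent defining `Λ` leaves 2^(-(n+1)) after the union bound over representatives.
      have e : 2 * growth d a n ^ 2 / (4 ^ d * (dens d a n / samples d n * (samples d n / 2 ^ n)))
          = (n + 1 : ℕ) * Λ := by
        rw [growth, Real.sq_sqrt (by positivity)]
        push_cast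
        field_simp
        exact hΛ.symm
      rw [e, ← mul_neg, Real.exp_nat_mul, Real.exp_neg, hΛ, Real.exp_log (by positivity)]
  let B : ℕ → Set (Choices d) := fun n => ⋃ j₀, ⋃ l ∈ F n j₀, bad n j₀ l
  have hB : ∀ n, (choiceMeasure d) (B n) ≤ ENNReal.ofReal (d * (1 / 2 : ℝ) ^ (n + 1)) := by
    intro n
    refine (measure_iUnion_le _).trans ?_
    rw [tsum_fintype]
    have h1 : ∀ j₀ : Fin d, (choiceMeasure d) (⋃ l ∈ F n j₀, bad n j₀ l)
        ≤ ENNReal.ofReal ((1 / 2 : ℝ) ^ (n + 1)) := by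
      intro j₀
      refine (measure_biUnion_finset_le _ _).trans
        ((Finset.sum_le_card_nsmul _ _ _ (hbad n j₀)).trans ?_)
      rw [nsmul_eq_mul, ← ENNReal.ofReal_natCast, ← ENNReal.ofReal_mul (by positivity)]
      refine ENNReal.ofReal_le_ofReal ?_
      have h2 : ((F n j₀).card : ℝ) ≤ ((2 : ℝ) ^ (2 * d * (d + 8))) ^ (n + 1) := by
        exact_mod_cast (hFcard n j₀).trans (card_graphLines_bound d n)
      refine (mul_le_mul_of_nonneg_right h2 (by positivity)).trans_eq ?_
      rw [← mul_pow, pow_succ _ (2 * d * (d + 8))]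
      congr 1
      field_simp
    refine (Finset.sum_le_card_nsmul _ _ _ fun j₀ _ => h1 j₀).trans_eq ?_
    rw [Finset.card_univ, Fintype.card_fin, nsmul_eq_mul, ENNReal.ofReal_mul (by positivity),
      ENNReal.ofReal_natCast]
  have hsum : ∑' n, (choiceMeasure d) (B n) ≠ ∞ := by
    refine ne_top_of_le_ne_top ?_ (ENNReal.tsum_le_tsum hB)
    have hs : Summable fun n : ℕ => (d : ℝ) * (1 / 2 : ℝ) ^ (n + 1) :=
      ((summable_nat_add_iff 1).2 summable_geometric_two).mul_left _
    exact hs.tsum_ofReal_ne_top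
  filter_upwards [ae_eventually_notMem hsum] with ω hω
  filter_upwards [hω] with n hn j₀ p v hpv
  -- The representative shares the cell path at level `n + 1`, hence by halving also at level `n`,
  -- so both averages agree.
  obtain ⟨l, hl, hle⟩ := hFrep n j₀ p v hpv
  have hnot : ω ∉ bad n j₀ l := fun hmem =>
    hn (mem_iUnion.2 ⟨j₀, mem_iUnion₂.2 ⟨l, hl, hmem⟩⟩)
  have e1 : pathAverage a ω (n + 1) (samples d n) (cellPath (n + 1) (samples d n) p v)
      = pathAverage a ω (n + 1) (samples d n) (cellPath (n + 1) (samples d n) l.1 l.2) :=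
    pathAverage_congr hle
  have e2 : lineAverage a ω n p v
      = pathAverage a ω n (samples d n) (cellPath n (samples d n) l.1 l.2) := by
    refine pathAverage_congr fun j hj => ?_
    rw [← halfPath_cellPath n, ← halfPath_cellPath n]
    ext i
    simp only [halfPath, hle j hj]
  rw [e1, e2, ← halfPath_cellPath n]
  exact (lt_of_not_ge fun hcon => hnot hcon).le

/-- Almost surely the averages of all levels along all lines are uniformly bounded. -/
lemma ae_exists_lineAverage_le (ha : ∀ n, a n = 1 ∨ a n = 2 ^ d) (hg : Summable (growth d a)) :
    ∀ᵐ ω ∂(choiceMeasure d), ∃ M : ℝ, ∀ (n : ℕ) (j₀ : Fin d) (p v : Fin d → ℝ),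
      IsGraphLine j₀ p v → lineAverage a ω n p v ≤ M := by
  filter_upwards [ae_eventually_growth ha] with ω hω
  obtain ⟨n₀, hn₀⟩ := eventually_atTop.1 hω
  let δ : ℕ → ℝ := fun n => growth d a n + d * (1 / 2) ^ n
  have hδ0 : ∀ n, 0 ≤ δ n := fun n => add_nonneg (Real.sqrt_nonneg _) (by positivity)
  have hδ : Summable δ := hg.add (summable_geometric_two.mul_left _)
  have key : ∀ (n : ℕ) (j₀ : Fin d) (p v : Fin d → ℝ), IsGraphLine j₀ p v →
      max 1 (lineAverage a ω n p v)
        ≤ 2 ^ (d * n₀) * Real.exp (∑ k ∈ Finset.range n, δ k) := by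
    intro n j₀ p v h
    have hexp : ∀ n, 1 ≤ Real.exp (∑ k ∈ Finset.range n, δ k) := fun n =>
      Real.one_le_exp (Finset.sum_nonneg fun k _ => hδ0 k)
    -- Up to the random level `n₀` nothing is known about the growth; the trivial density bound
    -- serves there.
    have hsmall : ∀ n ≤ n₀, max 1 (lineAverage a ω n p v)
        ≤ 2 ^ (d * n₀) * Real.exp (∑ k ∈ Finset.range n, δ k) := by
      intro n hn
      refine le_trans (max_le (one_le_pow₀ one_le_two) ?_)
        (le_mul_of_one_le_right (by positivity) (hexp n))
      refine (pathAverage_le ha n _ _).trans ?_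
      exact pow_le_pow_right₀ one_le_two (Nat.mul_le_mul_left d hn)
    induction n with
    | zero => exact hsmall 0 (Nat.zero_le _)
    | succ n ih =>
      rcases lt_or_ge n n₀ with hn | hn
      · exact hsmall (n + 1) hn
      have h1 := hn₀ n hn j₀ p v h
      have h2 := lineAverage_succ_le (ω := ω) ha h n
      set y := max 1 (lineAverage a ω n p v) with hy
      have hy1 : 1 ≤ y := le_max_left _ _
      have hyl : lineAverage a ω n p v ≤ y := le_max_right _ _
      -- Since `y ≥ 1`, the additive sampling error is absorbed into the multiplicative one.
      have hstep : max 1 (lineAverage a ω (n + 1) p v) ≤ y * (δ n + 1) := by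
        refine max_le ?_ ?_
        · nlinarith [hδ0 n]
        · have h3 : (d : ℝ) * (1 / 2) ^ n ≤ y * (d * (1 / 2) ^ n) :=
            le_mul_of_one_le_left (by positivity) hy1
          simp only [δ]
          linarith
      refine hstep.trans ?_
      rw [Finset.sum_range_succ, Real.exp_add, ← mul_assoc]
      exact mul_le_mul ih (Real.add_one_le_exp _) (by linarith [hδ0 n]) (by positivity)
  refine ⟨2 ^ (d * n₀) * Real.exp (∑' k, δ k), fun n j₀ p v h => ?_⟩
  refine (le_max_right _ _).trans ((key n j₀ p v h).trans ?_)
  gcongr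
  exact hδ.sum_le_tsum _ fun k _ => hδ0 k

/-! ### Counting cubes in tubes and balls -/

lemma abs_coord_sub_le (x y : E d) (i : Fin d) : |x i - y i| ≤ dist x y := by
  rw [dist_eq_norm, ← Real.norm_eq_abs]
  exact PiLp.norm_apply_le (x - y) i

lemma mem_dyadicCube_iff {n : ℕ} {k : Fin d → ℕ} {x : E d} :
    x ∈ dyadicCube n k ↔ ∀ i, (k i : ℝ) ≤ 2 ^ n * x i ∧ 2 ^ n * x i ≤ k i + 1 := by
  refine forall_congr' fun i => ?_
  rw [div_le_iff₀ (by positivity), le_div_iff₀ (by positivity), mul_comm (x i)]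

/-- Parametrise by a coordinate in which the direction vector has maximal modulus. -/
lemma IsLine.exists_graph {L : Set (E d)} (hL : IsLine L) :
    ∃ (j₀ : Fin d) (p v : Fin d → ℝ), p j₀ = 0 ∧ v j₀ = 1 ∧ (∀ i, |v i| ≤ 1) ∧
      ∀ x ∈ L, ∀ i, x i = p i + v i * x j₀ := by
  obtain ⟨q, u, hu, rfl⟩ := hL
  have hne : ∃ i, u i ≠ 0 := by
    by_contra! h
    exact hu (PiLp.ext h)
  obtain ⟨i₁, hi₁⟩ := hne
  obtain ⟨j₀, -, hmax⟩ := Finset.exists_max_image Finset.univ (fun i => |u i|) ⟨i₁, by simp⟩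
  have hj : 0 < |u j₀| := (abs_pos.2 hi₁).trans_le (hmax i₁ (by simp))
  have hj0 : u j₀ ≠ 0 := abs_pos.1 hj
  refine ⟨j₀, fun i => q i - q j₀ * (u i / u j₀), fun i => u i / u j₀, ?_, ?_, ?_, ?_⟩
  · simp [hj0]
  · simp [hj0]
  · intro i
    rw [abs_div, div_le_one hj]
    exact hmax i (by simp)
  · rintro x ⟨t, rfl⟩ i
    simp only [PiLp.add_apply, PiLp.smul_apply, smul_eq_mul]
    field_simp
    ring

/-- The number of cubes of level `n` in a tube of width at most `2⁻ⁿ` is controlled by the line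
averages, by averaging over the shifts of the axis by a few cubes. -/
lemma card_meet_tube_le {M : ℝ} (hM0 : 0 ≤ M)
    (hM : ∀ (n : ℕ) (j₀ : Fin d) (p v : Fin d → ℝ),
      IsGraphLine j₀ p v → lineAverage a ω n p v ≤ M)
    {L : Set (E d)} (hL : IsLine L) {w : ℝ} (n : ℕ) (hw : 2 ^ n * w ≤ 1) :
    dens d a n / 2 ^ n * (meet a ω n (Metric.thickening w L)).card ≤ 9 ^ d * M := by
  classical
  set T := Metric.thickening w L with hT
  obtain ⟨j₀, p, v, hp0, hv0, hv, hLx⟩ := hL.exists_graph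
  have h2n : (1 : ℝ) ≤ 2 ^ n := one_le_pow₀ one_le_two
  have hpt : ∀ k ∈ meet a ω n T, ∃ x x' : E d, x ∈ dyadicCube n k ∧ x' ∈ L ∧
      ∀ i, |2 ^ n * x i - 2 ^ n * x' i| ≤ 1 := by
    intro k hk
    obtain ⟨-, x, hxk, hxT⟩ := mem_meet.1 hk
    obtain ⟨x', hx', hd⟩ := Metric.mem_thickening_iff.1 hxT
    refine ⟨x, x', hxk, hx', fun i => ?_⟩
    rw [← mul_sub, abs_mul, abs_of_pos (by positivity)]
    refine le_trans ?_ hw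
    gcongr
    exact (abs_coord_sub_le x x' i).trans hd.le
  rcases (meet a ω n T).eq_empty_or_nonempty with hem | ⟨k₁, hk₁⟩
  · rw [hem]
    simp only [Finset.card_empty, Nat.cast_zero, mul_zero]
    positivity
  -- The line comes close to a cube in the unit cube, so it has a point with coordinates at most 2
  -- in modulus. The shifts below add at most 4 more, within the bound 8 of `IsGraphLine`.
  have hp4 : ∀ i, |p i| ≤ 4 := by
    intro i
    obtain ⟨x, x', hxk, hx', hd⟩ := hpt k₁ hk₁
    have hb : ∀ i, |2 ^ n * x' i| ≤ 2 ^ n * 2 := by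
      intro i
      have hk := survivors_lt n k₁ (mem_surv.1 (mem_meet.1 hk₁).1) i
      have hk' : (k₁ i : ℝ) + 1 ≤ 2 ^ n := by exact_mod_cast hk
      obtain ⟨c1, c2⟩ := mem_dyadicCube_iff.1 hxk i
      have c3 : (0 : ℝ) ≤ k₁ i := by positivity
      have := abs_le.1 (hd i)
      rw [abs_le]
      constructor <;> linarith [this.1, this.2]
    have hb' : ∀ i, |x' i| ≤ 2 := by
      intro i
      have := hb i
      rw [abs_mul, abs_of_pos (by positivity)] at this
      exact le_of_mul_le_mul_left this (by positivity)
    have e : p i = x' i - v i * x' j₀ := by rw [hLx x' hx' i]; ring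
    rw [e]
    refine (abs_sub _ _).trans ?_
    rw [abs_mul]
    have := mul_le_mul (hv i) (hb' j₀) (abs_nonneg _) zero_le_one
    linarith [hb' i]
  -- Shifts by up to four cells; the dominant coordinate stays fixed to keep the base point
  -- normalised.
  let Z : Finset (Fin d → ℤ) := Fintype.piFinset fun i => if i = j₀ then {0} else Finset.Icc (-4) 4
  have hZ : ∀ z ∈ Z, z j₀ = 0 ∧ ∀ i, -4 ≤ z i ∧ z i ≤ 4 := by
    intro z hz
    rw [Fintype.mem_piFinset] at hz
    have h0 : z j₀ = 0 := by simpa using hz j₀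
    refine ⟨h0, fun i => ?_⟩
    by_cases hi : i = j₀
    · rw [hi, h0]; norm_num
    · simpa [hi] using hz i
  have hZcard : (Z.card : ℝ) ≤ 9 ^ d := by
    have : Z.card ≤ 9 ^ d := by
      rw [Fintype.card_piFinset]
      refine (Finset.prod_le_pow_card _ _ 9 fun i _ => ?_).trans (by simp)
      split_ifs <;> simp
    exact_mod_cast this
  let pz : (Fin d → ℤ) → Fin d → ℝ := fun z i => p i + z i / 2 ^ n
  have hgl : ∀ z ∈ Z, IsGraphLine j₀ (pz z) v := by
    intro z hz
    obtain ⟨z0, zb⟩ := hZ z hz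
    refine ⟨by simp [pz, hp0, z0], hv0, hv, fun i => ?_⟩
    refine (abs_add_le _ _).trans ?_
    have h1 : |(z i : ℝ) / 2 ^ n| ≤ 4 := by
      rw [abs_div, abs_of_pos (by positivity : (0 : ℝ) < 2 ^ n), div_le_iff₀ (by positivity)]
      have : |(z i : ℝ)| ≤ 4 := abs_le.2 ⟨by exact_mod_cast (zb i).1, by exact_mod_cast (zb i).2⟩
      nlinarith
    linarith [hp4 i]
  obtain ⟨q, hq, hmq⟩ := exists_samples_eq (d := d) (Nat.le_succ n)
  have hqr : (0 : ℝ) < q := by exact_mod_cast hq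
  set m := samples d n with hm
  have hcell : ∀ (z : Fin d → ℤ) (j : ℕ) (i : Fin d),
      cellPath n m (pz z) v j i = cellPath n m p v j i + z i := by
    intro z j i
    simp only [cellPath, pz]
    rw [← Int.floor_add_intCast]
    congr 1
    field_simp
    ring
  -- Consider the `q` samples whose dominant coordinate lies in that of the cube. In units of
  -- 2^(-n), the line is there within 2 of `x'` in every coordinate, `x'` is within 1 of `x`, and
  -- the cube has side 1. So the cell differs from `k` by at most 4, and the shift by this
  -- difference hits `k`.
  have hhit : ∀ k ∈ meet a ω n T, q ≤ ∑ z ∈ Z, hits (cellPath n m (pz z) v) m k := by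
    intro k hk
    obtain ⟨x, x', hxk, hx', hd⟩ := hpt k hk
    have hklt := survivors_lt n k (mem_surv.1 (mem_meet.1 hk).1) j₀
    rw [← card_filter_div_eq (2 ^ n) q (k j₀) hklt, ← hmq]
    refine (Finset.card_le_card fun j hj => ?_).trans (Finset.card_biUnion_le
      (s := Z) (t := fun z => (Finset.range m).filter fun j =>
        cellPath n m (pz z) v j = fun i => (k i : ℤ)))
    obtain ⟨hjm, hjk⟩ := Finset.mem_filter.1 hj
    refine Finset.mem_biUnion.2 ⟨fun i => k i - cellPath n m p v j i,
      Fintype.mem_piFinset.2 fun i => ?_, Finset.mem_filter.2 ⟨hjm, ?_⟩⟩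
    · have hdom : cellPath n m p v j j₀ = k j₀ := by
        have h0 : IsGraphLine j₀ p v := ⟨hp0, hv0, hv, fun i => (hp4 i).trans (by norm_num)⟩
        rw [hmq, cellPath_dominant h0 n hq, hjk]
      by_cases hi : i = j₀
      · subst hi
        simp [hdom]
      rw [if_neg hi, Finset.mem_Icc]
      have hs1 : (k j₀ : ℝ) ≤ 2 ^ n * (j / m : ℝ) ∧ 2 ^ n * (j / m : ℝ) ≤ k j₀ + 1 := by
        have e : (2 : ℝ) ^ n * (j / m : ℝ) = j / q := by
          rw [hmq]
          push_cast
          field_simp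
        rw [e, le_div_iff₀ hqr, div_le_iff₀ hqr]
        rw [Nat.div_eq_iff hq] at hjk
        constructor
        · exact_mod_cast hjk.1
        · have : j ≤ (k j₀ + 1) * q := by
            rw [add_mul, one_mul]
            omega
          exact_mod_cast this
      have c0 := mem_dyadicCube_iff.1 hxk j₀
      have ci := mem_dyadicCube_iff.1 hxk i
      have d0 := abs_le.1 (hd j₀)
      have di := abs_le.1 (hd i)
      have e1 : |2 ^ n * (j / m : ℝ) - 2 ^ n * x' j₀| ≤ 2 := by
        rw [abs_le]
        constructor <;> linarith [c0.1, c0.2, d0.1, d0.2, hs1.1, hs1.2]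
      have e2 : |v i * (2 ^ n * (j / m : ℝ) - 2 ^ n * x' j₀)| ≤ 2 := by
        rw [abs_mul]
        have := mul_le_mul (hv i) e1 (abs_nonneg _) zero_le_one
        linarith
      have e3 : 2 ^ n * (p i + v i * (j / m : ℝ))
          = 2 ^ n * x' i + v i * (2 ^ n * (j / m : ℝ) - 2 ^ n * x' j₀) := by
        rw [hLx x' hx' i]
        ring
      have e4 := abs_le.1 e2
      have f1 : cellPath n m p v j i ≤ (k i : ℤ) + 4 := by
        have h1 : ((cellPath n m p v j i : ℤ) : ℝ) ≤ 2 ^ n * (p i + v i * (j / m : ℝ)) :=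
          Int.floor_le _
        have : ((cellPath n m p v j i : ℤ) : ℝ) ≤ (k i : ℝ) + 4 := by
          linarith [e4.2, di.1, ci.2]
        exact_mod_cast this
      have f2 : (k i : ℤ) - 4 ≤ cellPath n m p v j i := by
        refine Int.le_floor.2 ?_
        push_cast
        linarith [e4.1, di.2, ci.1]
      constructor <;> linarith
    · ext i
      rw [hcell]
      ring
  have hsum : ∑ z ∈ Z, lineAverage a ω n (pz z) v ≤ 9 ^ d * M := by
    refine (Finset.sum_le_card_nsmul _ _ M fun z hz => hM n j₀ _ _ (hgl z hz)).trans ?_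
    rw [nsmul_eq_mul]
    gcongr
  refine le_trans ?_ hsum
  have hmr : (m : ℝ) = 2 ^ n * q := by rw [hmq]; push_cast; rfl
  have e5 : ∑ z ∈ Z, lineAverage a ω n (pz z) v = dens d a n / m *
      ∑ k ∈ surv a ω n, ((∑ z ∈ Z, hits (cellPath n m (pz z) v) m k : ℕ) : ℝ) := by
    simp only [lineAverage, pathAverage]
    rw [← Finset.mul_sum, Finset.sum_comm]
    push_cast
    rfl
  have e6 : ((q : ℝ) * (meet a ω n T).card) ≤
      ∑ k ∈ surv a ω n, ((∑ z ∈ Z, hits (cellPath n m (pz z) v) m k : ℕ) : ℝ) := by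
    have hms : meet a ω n T ⊆ surv a ω n := fun k hk => (mem_meet.1 hk).1
    refine le_trans ?_ (Finset.sum_le_sum_of_subset_of_nonneg hms fun _ _ _ => by positivity)
    rw [mul_comm, ← nsmul_eq_mul]
    exact Finset.card_nsmul_le_sum _ _ _ fun k hk => by exact_mod_cast hhit k hk
  rw [e5, hmr]
  have e7 : dens d a n / 2 ^ n * (meet a ω n T).card
      = dens d a n / (2 ^ n * q) * (q * (meet a ω n T).card) := by
    field_simp
  rw [e7]
  exact mul_le_mul_of_nonneg_left e6 (div_nonneg (dens_nonneg a n) (by positivity))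

/-- For `w ≤ 1` count at the level N with 2^(-N-1) < w ≤ 2^(-N) and use monotonicity of fractions;
rounding w turns 9 into 18. For `w > 1` the fraction is at most 1 anyway. -/
lemma eventually_card_meet_tube_le (hd : 1 ≤ d) (ha : ∀ n, a n = 1 ∨ a n = 2 ^ d) {M : ℝ}
    (hM0 : 1 ≤ M)
    (hM : ∀ (n : ℕ) (j₀ : Fin d) (p v : Fin d → ℝ),
      IsGraphLine j₀ p v → lineAverage a ω n p v ≤ M)
    {L : Set (E d)} (hL : IsLine L) {w : ℝ} (hw : 0 < w) :
    ∀ᶠ n in atTop, ((meet a ω n (Metric.thickening w L)).card : ℝ) / pop a n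
      ≤ 18 ^ d * M * w ^ (d - 1) := by
  set T := Metric.thickening w L
  have hpop : ∀ n, (0 : ℝ) < pop a n := fun n => by exact_mod_cast pop_pos ha n
  rcases le_or_gt w 1 with hw1 | hw1
  · obtain ⟨N, hN1, hN2⟩ := exists_nat_pow_near_of_lt_one hw hw1
      (by norm_num : (0 : ℝ) < 1 / 2) (by norm_num)
    have hpos : (0 : ℝ) < 2 ^ N := by positivity
    rw [one_div, inv_pow] at hN1 hN2
    have hb1 : 2 ^ N * w ≤ 1 := by
      have := mul_le_mul_of_nonneg_left hN2 hpos.le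
      rwa [mul_inv_cancel₀ hpos.ne'] at this
    have hb2 : 1 ≤ 2 ^ N * (2 * w) := by
      rw [pow_succ, inv_lt_iff_one_lt_mul₀ (by positivity)] at hN1
      linarith
    have hcard := card_meet_tube_le (by linarith) hM hL N hb1
    filter_upwards [eventually_ge_atTop N] with n hn
    refine (card_meet_div_pop_le ha hn T).trans ?_
    have e1 : dens d a N / 2 ^ N = (2 ^ N) ^ (d - 1) / pop a N := by
      obtain ⟨e, rfl⟩ := Nat.exists_eq_add_of_le hd
      rw [dens, Nat.add_sub_cancel_left, add_mul, one_mul, pow_add, mul_comm e, pow_mul]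
      field_simp
    rw [e1] at hcard
    set c := ((meet a ω N T).card : ℝ) / pop a N with hc
    have hc0 : 0 ≤ c := by positivity
    have hcard' : (2 ^ N) ^ (d - 1) * c ≤ 9 ^ d * M := by
      rw [hc]
      refine le_trans (le_of_eq ?_) hcard
      ring
    have e2 : (1 : ℝ) ≤ (2 ^ N) ^ (d - 1) * (2 * w) ^ (d - 1) := by
      rw [← mul_pow]
      exact one_le_pow₀ hb2
    have e3 : (2 : ℝ) ^ (d - 1) ≤ 2 ^ d := pow_le_pow_right₀ one_le_two (Nat.sub_le _ _)
    calc c ≤ ((2 ^ N) ^ (d - 1) * (2 * w) ^ (d - 1)) * c := le_mul_of_one_le_left hc0 e2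
      _ = ((2 ^ N) ^ (d - 1) * c) * (2 * w) ^ (d - 1) := by ring
      _ ≤ (9 ^ d * M) * (2 * w) ^ (d - 1) := by gcongr
      _ = (9 ^ d * M) * (2 ^ (d - 1) * w ^ (d - 1)) := by rw [mul_pow]
      _ ≤ (9 ^ d * M) * (2 ^ d * w ^ (d - 1)) := by gcongr
      _ = 18 ^ d * M * w ^ (d - 1) := by
        rw [show (18 : ℝ) = 9 * 2 by norm_num, mul_pow]; ring
  · filter_upwards with n
    have h1 : ((meet a ω n T).card : ℝ) / pop a n ≤ 1 :=
      (div_le_one (hpop n)).2 (by exact_mod_cast card_meet_le_pop ha n T)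
    refine h1.trans ?_
    have h2 : (1 : ℝ) ≤ w ^ (d - 1) := one_le_pow₀ hw1.le
    have h3 : (1 : ℝ) ≤ 18 ^ d := one_le_pow₀ (by norm_num)
    exact one_le_mul_of_one_le_of_one_le (one_le_mul_of_one_le_of_one_le h3 hM0) h2

lemma card_meet_ball_le (n : ℕ) (x : E d) {ρ : ℝ} (hρ : 2 ^ n * ρ ≤ 1) :
    (meet a ω n (Metric.ball x (2 * ρ))).card ≤ 6 ^ d := by
  classical
  let B : Finset (Fin d → ℤ) := Fintype.piFinset fun i =>
    Finset.Icc (⌊2 ^ n * x i⌋ - 3) (⌊2 ^ n * x i⌋ + 2)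
  have hB : B.card = 6 ^ d := by
    have : ∀ z : ℤ, (z + 2 + 1 - (z - 3)).toNat = 6 := fun z => by
      rw [show z + 2 + 1 - (z - 3) = 6 by ring]; rfl
    simp [B, this]
  rw [← hB]
  refine Finset.card_le_card_of_injOn (fun k i => (k i : ℤ)) (fun k hk => ?_) ?_
  · obtain ⟨-, y, hyk, hyx⟩ := mem_meet.1 hk
    refine Fintype.mem_piFinset.2 fun i => ?_
    have h1 : |2 ^ n * y i - 2 ^ n * x i| ≤ 2 := by
      rw [← mul_sub, abs_mul, abs_of_pos (by positivity)]
      have h2 : |y i - x i| ≤ 2 * ρ := (abs_coord_sub_le y x i).trans (Metric.mem_ball.1 hyx).le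
      calc (2 : ℝ) ^ n * |y i - x i| ≤ 2 ^ n * (2 * ρ) := by gcongr
        _ ≤ 2 := by linarith
    obtain ⟨h2, h3⟩ := abs_le.1 h1
    obtain ⟨h4, h5⟩ := mem_dyadicCube_iff.1 hyk i
    have h6 := Int.floor_le (2 ^ n * x i)
    have h7 := Int.lt_floor_add_one (2 ^ n * x i)
    rw [Finset.mem_Icc]
    constructor
    · have : ((⌊2 ^ n * x i⌋ - 3 : ℤ) : ℝ) ≤ ((k i : ℤ) : ℝ) := by
        push_cast
        linarith
      exact_mod_cast this
    · have : ((k i : ℤ) : ℝ) < ((⌊2 ^ n * x i⌋ + 3 : ℤ) : ℝ) := by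
        push_cast
        linarith
      exact Int.lt_add_one_iff.1 ((Int.cast_lt.1 this).trans_eq (by ring))
  · intro k _ k' _ e
    ext i
    exact Int.natCast_inj.1 (congrFun e i)

variable {h : ℝ → ℝ}

/-! ### Hausdorff measure estimates -/

lemma gaugeENN_le (hh : IsGauge h) {x : ℝ≥0∞} {ρ : ℝ} (hρ : 0 < ρ) (hx : x ≤ ENNReal.ofReal ρ) :
    gaugeENN h x ≤ ENNReal.ofReal (h ρ) := by
  unfold gaugeENN
  have htop : x ≠ ∞ := ne_top_of_le_ne_top ENNReal.ofReal_ne_top hx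
  split_ifs with h0
  · exact zero_le
  · refine ENNReal.ofReal_le_ofReal (hh.mono (ENNReal.toReal_pos h0 htop) hρ ?_)
    exact ENNReal.toReal_le_of_le_ofReal hρ.le hx

lemma gauge_two_pow_mul_le (hdbl : ∀ t : ℝ, 0 < t → h (2 * t) ≤ 2 ^ d * h t) {t : ℝ} (ht : 0 < t)
    (j : ℕ) : h (2 ^ j * t) ≤ (2 ^ d) ^ j * h t := by
  induction j with
  | zero => simp
  | succ j ih =>
    have h1 := hdbl (2 ^ j * t) (by positivity)
    rw [pow_succ', mul_assoc, pow_succ', mul_assoc]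
    exact h1.trans (mul_le_mul_of_nonneg_left ih (by positivity))

lemma gauge_level_le (hdbl : ∀ t : ℝ, 0 < t → h (2 * t) ≤ 2 ^ d * h t) (n j : ℕ) :
    h ((2 : ℝ)⁻¹ ^ n) ≤ (2 ^ d) ^ j * h ((2 : ℝ)⁻¹ ^ (n + j)) := by
  have := gauge_two_pow_mul_le hdbl (t := (2 : ℝ)⁻¹ ^ (n + j)) (by positivity) j
  have e : (2 : ℝ) ^ j * 2⁻¹ ^ (n + j) = 2⁻¹ ^ n := by
    rw [pow_add, mul_comm ((2 : ℝ)⁻¹ ^ n), ← mul_assoc, ← mul_pow]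
    norm_num
  rwa [e] at this

/-- Makes the diameter of a cube at most its side `d` dyadic scales up, so that in the gauge it
costs `d` doublings. -/
lemma sqrt_natCast_le_two_pow (d : ℕ) : √(d : ℝ) ≤ 2 ^ d := by
  rw [Real.sqrt_le_left (by positivity)]
  have h1 : (d : ℝ) ≤ 2 ^ d := by exact_mod_cast d.lt_two_pow_self.le
  have h2 : (1 : ℝ) ≤ 2 ^ d := one_le_pow₀ one_le_two
  nlinarith

/-- The gauge measure of a subset of the limit set is bounded by the proportion of surviving cubes
that it meets. -/
lemma hausdorffGauge_le (hh : IsGauge h)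
    (hdbl : ∀ t : ℝ, 0 < t → h (2 * t) ≤ 2 ^ d * h t) (ha : ∀ n, a n = 1 ∨ a n = 2 ^ d)
    {K c : ℝ} (hK : ∀ n, (pop a n : ℝ) * h ((2 : ℝ)⁻¹ ^ n) ≤ K) (hc : 0 ≤ c)
    {S : Set (E d)} (hS : S ⊆ limitSet a ω)
    (hcard : ∀ᶠ n in atTop, ((meet a ω n S).card : ℝ) / pop a n ≤ c) :
    hausdorffGauge d h S ≤ ENNReal.ofReal ((2 ^ d) ^ d * K * c) := by
  have hpop : ∀ n, (0 : ℝ) < pop a n := fun n => by exact_mod_cast pop_pos ha n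
  have hdiam : ∀ (n : ℕ) (k : Fin d → ℕ),
      Metric.ediam (dyadicCube n k) ≤ ENNReal.ofReal (2 ^ d * (2 : ℝ)⁻¹ ^ n) := by
    intro n k
    refine Metric.ediam_le fun x hx y hy => ?_
    rw [edist_dist]
    refine ENNReal.ofReal_le_ofReal ((dist_le_of_mem_dyadicCube hx hy).trans ?_)
    gcongr
    exact sqrt_natCast_le_two_pow d
  have hr : Tendsto (fun n : ℕ => ENNReal.ofReal (2 ^ d * (2 : ℝ)⁻¹ ^ n)) atTop (𝓝 0) := by
    rw [← ENNReal.ofReal_zero]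
    refine ENNReal.tendsto_ofReal ?_
    have := (tendsto_pow_atTop_nhds_zero_of_lt_one (r := (2 : ℝ)⁻¹) (by norm_num)
      (by norm_num)).const_mul ((2 : ℝ) ^ d)
    rwa [mul_zero] at this
  have key := Measure.mkMetric_le_liminf_sum (ι := fun n => meet a ω n S) S
    (fun n : ℕ => ENNReal.ofReal (2 ^ d * (2 : ℝ)⁻¹ ^ n)) hr
    (fun n k => dyadicCube n k.1) (Eventually.of_forall fun n k => hdiam n k.1)
    (Eventually.of_forall fun n => by
      refine (limitSet_subset_meet n hS).trans ?_
      rw [iUnion_subtype]) (gaugeENN h)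
  refine key.trans ?_
  refine (liminf_le_liminf (v := fun _ => ENNReal.ofReal ((2 ^ d) ^ d * K * c)) ?_).trans
    (liminf_const _).le
  filter_upwards [hcard] with n hn
  have hgp : 0 < h ((2 : ℝ)⁻¹ ^ n) := hh.pos _ (by positivity)
  calc ∑ k : meet a ω n S, gaugeENN h (Metric.ediam (dyadicCube n k.1))
      ≤ ∑ k : meet a ω n S, ENNReal.ofReal ((2 ^ d) ^ d * h ((2 : ℝ)⁻¹ ^ n)) := by
        refine Finset.sum_le_sum fun k _ => (gaugeENN_le hh (by positivity) (hdiam n k.1)).trans ?_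
        exact ENNReal.ofReal_le_ofReal (gauge_two_pow_mul_le hdbl (by positivity) d)
    _ = ENNReal.ofReal ((meet a ω n S).card * ((2 ^ d) ^ d * h ((2 : ℝ)⁻¹ ^ n))) := by
        rw [Finset.sum_const, Finset.card_univ, Fintype.card_coe, nsmul_eq_mul,
          ← ENNReal.ofReal_natCast, ← ENNReal.ofReal_mul (by positivity)]
    _ ≤ ENNReal.ofReal ((2 ^ d) ^ d * K * c) := by
        refine ENNReal.ofReal_le_ofReal ?_
        rw [div_le_iff₀ (hpop n)] at hn
        calc ((meet a ω n S).card : ℝ) * ((2 ^ d) ^ d * h ((2 : ℝ)⁻¹ ^ n))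
            ≤ (c * pop a n) * ((2 ^ d) ^ d * h ((2 : ℝ)⁻¹ ^ n)) := by gcongr
          _ = (2 ^ d) ^ d * c * (pop a n * h ((2 : ℝ)⁻¹ ^ n)) := by ring
          _ ≤ (2 ^ d) ^ d * c * K := by gcongr; exact hK n
          _ = _ := by ring

/-- Every nonempty set of diameter at most one lies in a ball whose radius is comparable to its
diameter in terms of the gauge. -/
lemma exists_ball_of_ediam_le_one (hh : IsGauge h) {s : Set (E d)} (hs : Metric.ediam s ≤ 1)
    {ε : NNReal} (hε : 0 < ε) : ∃ (x : E d) (ρ : ℝ), 0 < ρ ∧ ρ ≤ 1 ∧ s ⊆ Metric.ball x (2 * ρ) ∧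
      ENNReal.ofReal (h ρ) ≤ (⨆ _ : s.Nonempty, gaugeENN h (Metric.ediam s)) + ε := by
  -- Empty sets and points have gauge 0 but need a ball of positive radius; `ε` pays for it.
  have hsmall : ∃ ρ : ℝ, 0 < ρ ∧ ρ ≤ 1 ∧ h ρ ≤ ε := by
    have h1 : ∀ᶠ t in 𝓝[>] (0 : ℝ), h t < ε := hh.tendsto_zero.eventually_lt_const
      (show (0 : ℝ) < ε from hε)
    have h2 : ∀ᶠ t in 𝓝[>] (0 : ℝ), t ∈ Ioo (0 : ℝ) 1 := Ioo_mem_nhdsGT one_pos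
    obtain ⟨ρ, h3, h4⟩ := (h1.and h2).exists
    exact ⟨ρ, h4.1, h4.2.le, h3.le⟩
  obtain ⟨ρ, hρ0, hρ1, hρε⟩ := hsmall
  have hρε' : ENNReal.ofReal (h ρ) ≤ ε := ENNReal.ofReal_le_of_le_toReal (by simpa using hρε)
  rcases s.eq_empty_or_nonempty with rfl | hne
  · exact ⟨0, ρ, hρ0, hρ1, empty_subset _, hρε'.trans le_add_self⟩
  obtain ⟨x, hx⟩ := hne
  have htop : Metric.ediam s ≠ ∞ := ne_top_of_le_ne_top ENNReal.one_ne_top hs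
  by_cases h0 : Metric.ediam s = 0
  · refine ⟨x, ρ, hρ0, hρ1, fun y hy => ?_, hρε'.trans le_add_self⟩
    have : edist y x ≤ 0 := h0 ▸ Metric.edist_le_ediam_of_mem hy hx
    rw [edist_eq_zero.1 (le_antisymm this zero_le)]
    exact Metric.mem_ball_self (by positivity)
  · have hD : 0 < (Metric.ediam s).toReal := ENNReal.toReal_pos h0 htop
    refine ⟨x, (Metric.ediam s).toReal, hD, ?_, fun y hy => ?_, ?_⟩
    · exact ENNReal.toReal_le_of_le_ofReal zero_le_one (by simpa using hs)
    · have h1 := Metric.edist_le_ediam_of_mem hy hx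
      rw [edist_dist, ENNReal.ofReal_le_iff_le_toReal htop] at h1
      rw [Metric.mem_ball]
      linarith
    · rw [iSup_pos ⟨x, hx⟩, gaugeENN, if_neg h0, if_neg htop]
      exact le_self_add

/-- A cover may be replaced by finitely many open balls, which by compactness cover some stage. A
ball of radius ρ meets at most a fraction O(h(ρ)) of the late cubes, and these fractions add up to
at least 1. -/
lemma hausdorffGauge_limitSet_pos (hh : IsGauge h)
    (hdbl : ∀ t : ℝ, 0 < t → h (2 * t) ≤ 2 ^ d * h t) (ha : ∀ n, a n = 1 ∨ a n = 2 ^ d)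
    {K : ℝ} (hK0 : 0 < K) (hK : ∀ n, 1 / (pop a n : ℝ) ≤ K * h ((2 : ℝ)⁻¹ ^ n)) :
    0 < hausdorffGauge d h (limitSet a ω) := by
  have hpop : ∀ n, (0 : ℝ) < pop a n := fun n => by exact_mod_cast pop_pos ha n
  set c : ℝ := (6 ^ d * (K * 2 ^ d))⁻¹ with hc
  have hcpos : 0 < c := by positivity
  have hcc : c * (6 ^ d * (K * 2 ^ d)) = 1 := inv_mul_cancel₀ (by positivity)
  refine lt_of_lt_of_le (ENNReal.ofReal_pos.2 hcpos) ?_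
  rw [hausdorffGauge, Measure.mkMetric_apply]
  refine le_iSup₂_of_le 1 one_pos (le_iInf fun t => le_iInf fun hcov => le_iInf fun hdiam => ?_)
  refine ENNReal.le_of_forall_pos_le_add fun ε hε _ => ?_
  obtain ⟨ε', hε', hsum⟩ := ENNReal.exists_pos_sum_of_countable
    (ENNReal.coe_ne_zero.2 hε.ne') ℕ
  choose x ρ hρ0 hρ1 hsub hle using fun n => exists_ball_of_ediam_le_one hh (hdiam n) (hε' n)
  obtain ⟨s, hs⟩ := isCompact_limitSet.elim_finite_subcover
    (fun n => Metric.ball (x n) (2 * ρ n)) (fun n => Metric.isOpen_ball)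
    (hcov.trans (iUnion_mono hsub))
  obtain ⟨N₀, hN₀⟩ := exists_stageSet_subset
    (isOpen_biUnion fun n (_ : n ∈ s) => Metric.isOpen_ball) hs
  have hball : ∀ n, ∀ᶠ N in atTop,
      ((meet a ω N (Metric.ball (x n) (2 * ρ n))).card : ℝ) / pop a N
        ≤ 6 ^ d * (K * 2 ^ d) * h (ρ n) := by
    intro n
    obtain ⟨l, hl1, hl2⟩ := exists_nat_pow_near_of_lt_one (hρ0 n) (hρ1 n)
      (by norm_num : (0 : ℝ) < 2⁻¹) (by norm_num)
    filter_upwards [eventually_ge_atTop l] with N hN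
    refine (card_meet_div_pop_le ha hN _).trans ?_
    have h1 : 2 ^ l * ρ n ≤ 1 := by
      have := mul_le_mul_of_nonneg_left hl2 (by positivity : (0 : ℝ) ≤ 2 ^ l)
      rwa [inv_pow, mul_inv_cancel₀ (by positivity)] at this
    have h2 : ((meet a ω l (Metric.ball (x n) (2 * ρ n))).card : ℝ) ≤ 6 ^ d := by
      exact_mod_cast card_meet_ball_le l (x n) h1
    have h3 : h ((2 : ℝ)⁻¹ ^ l) ≤ 2 ^ d * h (ρ n) := by
      have h4 := gauge_level_le hdbl l 1
      rw [pow_one] at h4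
      refine h4.trans ?_
      gcongr
      exact hh.mono (by simp) (hρ0 n) hl1.le
    calc ((meet a ω l (Metric.ball (x n) (2 * ρ n))).card : ℝ) / pop a l
        ≤ 6 ^ d / pop a l := by gcongr
      _ = 6 ^ d * (1 / pop a l) := by ring
      _ ≤ 6 ^ d * (K * h ((2 : ℝ)⁻¹ ^ l)) := by gcongr; exact hK l
      _ ≤ 6 ^ d * (K * (2 ^ d * h (ρ n))) := by gcongr
      _ = _ := by ring
  obtain ⟨N, hN, hNN⟩ := (((Filter.eventually_all_finset s).2 fun n _ => hball n).and
    (eventually_ge_atTop N₀)).exists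
  have hfull : meet a ω N (⋃ n ∈ s, Metric.ball (x n) (2 * ρ n)) = surv a ω N := by
    ext k
    rw [mem_meet]
    refine and_iff_left_of_imp fun hk => ?_
    obtain ⟨y, hy⟩ := dyadicCube_nonempty N k
    refine ⟨y, hy, hN₀ (stageSet_antitone hNN ?_)⟩
    rw [stageSet_eq]
    exact mem_iUnion₂.2 ⟨k, hk, hy⟩
  have hone : (1 : ℝ) ≤ ∑ n ∈ s, 6 ^ d * (K * 2 ^ d) * h (ρ n) := by
    have h1 := card_meet_le_sum (a := a) (ω := ω) s N _
      (fun n => Metric.ball (x n) (2 * ρ n)) Subset.rfl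
    rw [hfull, card_surv ha] at h1
    have h2 : (pop a N : ℝ) ≤
        ∑ n ∈ s, ((meet a ω N (Metric.ball (x n) (2 * ρ n))).card : ℝ) := by exact_mod_cast h1
    calc (1 : ℝ) = pop a N / pop a N := (div_self (hpop N).ne').symm
      _ ≤ (∑ n ∈ s, ((meet a ω N (Metric.ball (x n) (2 * ρ n))).card : ℝ)) / pop a N := by
        gcongr
      _ = ∑ n ∈ s, ((meet a ω N (Metric.ball (x n) (2 * ρ n))).card : ℝ) / pop a N :=
        Finset.sum_div _ _ _
      _ ≤ _ := Finset.sum_le_sum hN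
  have hcs : c ≤ ∑ n ∈ s, h (ρ n) := by
    rw [← Finset.mul_sum] at hone
    have := mul_le_mul_of_nonneg_left hone hcpos.le
    rwa [← mul_assoc, hcc, one_mul, mul_one] at this
  calc ENNReal.ofReal c ≤ ENNReal.ofReal (∑ n ∈ s, h (ρ n)) := ENNReal.ofReal_le_ofReal hcs
    _ = ∑ n ∈ s, ENNReal.ofReal (h (ρ n)) :=
      ENNReal.ofReal_sum_of_nonneg fun n _ => (hh.pos _ (hρ0 n)).le
    _ ≤ ∑' n, ENNReal.ofReal (h (ρ n)) := ENNReal.sum_le_tsum s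
    _ ≤ ∑' n, ((⨆ _ : (t n).Nonempty, gaugeENN h (Metric.ediam (t n))) + ε' n) :=
      ENNReal.tsum_le_tsum hle
    _ = (∑' n, ⨆ _ : (t n).Nonempty, gaugeENN h (Metric.ediam (t n))) + ∑' n, (ε' n : ℝ≥0∞) :=
      ENNReal.tsum_add
    _ ≤ _ := by gcongr

/-- If all line averages are bounded, then no Borel subset of positive gauge measure is tube
null. -/
lemma not_isTubeNull_of_lineAverage_le (hd : 1 ≤ d) (hh : IsGauge h)
    (hdbl : ∀ t : ℝ, 0 < t → h (2 * t) ≤ 2 ^ d * h t) (ha : ∀ n, a n = 1 ∨ a n = 2 ^ d)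
    {K M : ℝ} (hK : ∀ n, (pop a n : ℝ) * h ((2 : ℝ)⁻¹ ^ n) ≤ K) (hM1 : 1 ≤ M)
    (hM : ∀ (n : ℕ) (j₀ : Fin d) (p v : Fin d → ℝ),
      IsGraphLine j₀ p v → lineAverage a ω n p v ≤ M)
    (hfin : hausdorffGauge d h (limitSet a ω) < ∞)
    {B : Set (E d)} (hB : B ⊆ limitSet a ω) (hBm : MeasurableSet B)
    (hBpos : 0 < hausdorffGauge d h B) : ¬ IsTubeNull B := by
  intro hnull
  have hK0 : 0 ≤ K := le_trans (mul_nonneg (by positivity) (hh.pos _ (by positivity)).le) (hK 0)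
  -- Finiteness gives inner regularity, hence a compact subset of `B` of positive measure.
  -- Compactness matters since tubes are open: finitely many then suffice, and a common late level
  -- serves all of them.
  have : IsFiniteMeasure ((hausdorffGauge d h).restrict (limitSet a ω)) :=
    ⟨by rwa [Measure.restrict_apply_univ]⟩
  have hBpos' : 0 < (hausdorffGauge d h).restrict (limitSet a ω) B := by
    rwa [Measure.restrict_apply hBm, inter_eq_self_of_subset_left hB]
  obtain ⟨S, hSB, hSc, hSpos⟩ := hBm.exists_lt_isCompact hBpos'
  rw [Measure.restrict_apply hSc.measurableSet,
    inter_eq_self_of_subset_left (hSB.trans hB)] at hSpos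
  have key : ∀ δ : ℝ, 0 < δ →
      hausdorffGauge d h S ≤ ENNReal.ofReal ((2 ^ d) ^ d * K * (18 ^ d * M * δ)) := by
    intro δ hδ
    obtain ⟨T, -, hT, hcov, hsum⟩ := hnull δ hδ
    have hcov' : S ⊆ ⋃ τ : T, Metric.thickening τ.1.2 τ.1.1 := by
      rw [iUnion_subtype]
      exact hSB.trans hcov
    obtain ⟨s, hs⟩ := hSc.elim_finite_subcover _ (fun τ => Metric.isOpen_thickening) hcov'
    have hsδ : ∑ τ ∈ s, τ.1.2 ^ (d - 1) ≤ δ := by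
      have h1 := (ENNReal.sum_le_tsum s).trans hsum
      rw [← ENNReal.ofReal_sum_of_nonneg fun τ _ => pow_nonneg (hT τ.1 τ.2).2.le _] at h1
      exact (ENNReal.ofReal_le_ofReal_iff hδ.le).1 h1
    refine hausdorffGauge_le hh hdbl ha hK (by positivity) (hSB.trans hB) ?_
    filter_upwards [(Filter.eventually_all_finset s).2 fun τ _ =>
      eventually_card_meet_tube_le hd ha hM1 hM (hT τ.1 τ.2).1 (hT τ.1 τ.2).2] with n hn
    have h2 : ((meet a ω n S).card : ℝ) ≤
        ∑ τ ∈ s, ((meet a ω n (Metric.thickening τ.1.2 τ.1.1)).card : ℝ) := by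
      exact_mod_cast card_meet_le_sum s n S _ hs
    calc ((meet a ω n S).card : ℝ) / pop a n
        ≤ (∑ τ ∈ s, ((meet a ω n (Metric.thickening τ.1.2 τ.1.1)).card : ℝ)) / pop a n := by
          gcongr
      _ = ∑ τ ∈ s, ((meet a ω n (Metric.thickening τ.1.2 τ.1.1)).card : ℝ) / pop a n :=
          Finset.sum_div _ _ _
      _ ≤ ∑ τ ∈ s, 18 ^ d * M * τ.1.2 ^ (d - 1) := Finset.sum_le_sum hn
      _ = 18 ^ d * M * ∑ τ ∈ s, τ.1.2 ^ (d - 1) := by rw [Finset.mul_sum]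
      _ ≤ 18 ^ d * M * δ := by gcongr
  have hlim : Tendsto (fun δ : ℝ => ENNReal.ofReal ((2 ^ d) ^ d * K * (18 ^ d * M * δ)))
      (𝓝[>] 0) (𝓝 0) := by
    rw [← ENNReal.ofReal_zero]
    refine ENNReal.tendsto_ofReal (Tendsto.mono_left ?_ nhdsWithin_le_nhds)
    have : Continuous fun δ : ℝ => (2 ^ d : ℝ) ^ d * K * (18 ^ d * M * δ) := by fun_prop
    simpa using this.tendsto 0
  exact hSpos.not_ge (ge_of_tendsto hlim (eventually_nhdsWithin_of_forall fun δ hδ => key δ hδ))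

/-! ### Summability, the branching sequence, and the conclusion -/

lemma cast_pop (a : ℕ → ℕ) (n : ℕ) : (pop a n : ℝ) = ∏ i ∈ Finset.range n, (a i : ℝ) := by
  simp [pop]

/-- On (2^(-n-2), 2^(-n-1)) the integrand is at least 2^(n+1) √(X n), so its integral there is at
least √(X n) / 2; by doubling, `growth` at `n + 1` is at most a multiple of √(X n). Starting below
1/2 avoids the zero of the logarithm at 1. -/
lemma summable_growth (hd : 1 ≤ d) (hh : IsGauge h)
    (hdbl : ∀ t : ℝ, 0 < t → h (2 * t) ≤ 2 ^ d * h t)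
    (hint : IntegrableOn (fun t : ℝ => t⁻¹ * √(t ^ (1 - (d : ℤ)) * |Real.log t| * h t)) (Ioo 0 1))
    {K : ℝ} (hK0 : 0 < K) (hK : ∀ n, 1 / (pop a n : ℝ) ≤ K * h ((2 : ℝ)⁻¹ ^ n)) :
    Summable (growth d a) := by
  set F : ℝ → ℝ := fun t => t⁻¹ * √(t ^ (1 - (d : ℤ)) * |Real.log t| * h t) with hF
  obtain ⟨e, rfl⟩ := Nat.exists_eq_add_of_le hd
  let I : ℕ → Set ℝ := fun n => Ioo ((2 : ℝ)⁻¹ ^ (n + 2)) ((2 : ℝ)⁻¹ ^ (n + 1))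
  have hpow : ∀ {m n : ℕ}, m ≤ n → (2 : ℝ)⁻¹ ^ n ≤ (2 : ℝ)⁻¹ ^ m := fun hmn =>
    pow_le_pow_of_le_one (by norm_num) (by norm_num) hmn
  have hI : ∀ n, I n ⊆ Ioo 0 1 := fun n =>
    Ioo_subset_Ioo (by positivity) (pow_le_one₀ (by norm_num) (by norm_num))
  have hdisj : Pairwise (Function.onFun Disjoint I) := by
    refine (pairwise_disjoint_on I).2 fun m n hmn => ?_
    refine Set.disjoint_left.2 fun t ht ht' => ?_
    have := hpow (show m + 2 ≤ n + 1 by omega)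
    exact absurd (ht'.2.trans_le this) (not_lt.2 ht.1.le)
  have hsum : Summable fun n => ∫ t in I n, F t :=
    (hasSum_integral_iUnion (fun n => measurableSet_Ioo) hdisj
      (hint.mono_set (iUnion_subset hI))).summable
  let X : ℕ → ℝ := fun n =>
    2 ^ (e * (n + 1)) * ((n + 1 : ℕ) * Real.log 2) * h ((2 : ℝ)⁻¹ ^ (n + 2))
  have hl2 : 0 < Real.log 2 := Real.log_pos one_lt_two
  have hX0 : ∀ n, 0 ≤ X n := fun n => by
    have := hh.pos ((2 : ℝ)⁻¹ ^ (n + 2)) (by positivity)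
    positivity
  have hlow : ∀ n, √(X n) / 2 ≤ ∫ t in I n, F t := by
    intro n
    have hconst : ∀ t ∈ I n, 2 ^ (n + 1) * √(X n) ≤ F t := by
      intro t ht
      have ht0 : 0 < t := (hI n ht).1
      have hinv : (2 : ℝ) ^ (n + 1) ≤ t⁻¹ := by
        rw [le_inv_comm₀ (by positivity) ht0, ← inv_pow]
        exact ht.2.le
      have hz : (2 : ℝ) ^ (e * (n + 1)) ≤ t ^ (1 - ((1 + e : ℕ) : ℤ)) := by
        have : (1 - ((1 + e : ℕ) : ℤ)) = -(e : ℤ) := by push_cast; ring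
        rw [this, zpow_neg, zpow_natCast, ← inv_pow, mul_comm, pow_mul]
        gcongr
      have hlog : ((n + 1 : ℕ) : ℝ) * Real.log 2 ≤ |Real.log t| := by
        have h1 : Real.log t ≤ Real.log ((2 : ℝ)⁻¹ ^ (n + 1)) := Real.log_le_log ht0 ht.2.le
        rw [Real.log_pow, Real.log_inv] at h1
        refine le_trans ?_ (neg_le_abs _)
        linarith
      have hht : h ((2 : ℝ)⁻¹ ^ (n + 2)) ≤ h t :=
        hh.mono (show (0 : ℝ) < _ by positivity) ht0 ht.1.le
      have hhp := (hh.pos ((2 : ℝ)⁻¹ ^ (n + 2)) (by positivity)).le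
      have hX : X n ≤ t ^ (1 - ((1 + e : ℕ) : ℤ)) * |Real.log t| * h t := by
        simp only [X]
        gcongr
      simp only [hF]
      gcongr
    have hFi : IntegrableOn F (I n) := hint.mono_set (hI n)
    have h1 := setIntegral_mono_on (μ := volume) (s := I n)
      (f := fun _ => 2 ^ (n + 1) * √(X n)) (g := F)
      (integrableOn_const (measure_Ioo_lt_top.ne)) hFi measurableSet_Ioo hconst
    refine le_trans (le_of_eq ?_) h1
    rw [setIntegral_const, Measure.real, Real.volume_Ioo, smul_eq_mul,
      ENNReal.toReal_ofReal (sub_nonneg.2 (hpow (by omega)))]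
    have e1 : (2 : ℝ)⁻¹ ^ (n + 1) * 2 ^ (n + 1) = 1 := by
      rw [← mul_pow]
      norm_num
    rw [pow_succ (2 : ℝ)⁻¹ (n + 1)]
    linear_combination (-(√(X n)) / 2) * e1
  set G : ℝ := 4 ^ (1 + e) / 2 * Real.log (2 ^ (2 * (1 + e) * ((1 + e) + 8) + 1)) with hG
  have hG0 : 0 ≤ G := mul_nonneg (by positivity) (Real.log_nonneg (one_le_pow₀ one_le_two))
  set D : ℝ := G * (2 / Real.log 2 * (K * 2 ^ (1 + e))) with hD
  have hD0 : 0 ≤ D := by positivity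
  have hup : ∀ n, growth (1 + e) a (n + 1) ≤ √D * √(X n) := by
    intro n
    rw [← Real.sqrt_mul hD0, growth, ← hG]
    refine Real.sqrt_le_sqrt ?_
    have h1 : dens (1 + e) a (n + 1) / 2 ^ (n + 1)
        ≤ 2 ^ (e * (n + 1)) * (K * (2 ^ (1 + e) * h ((2 : ℝ)⁻¹ ^ (n + 2)))) := by
      have h2 : dens (1 + e) a (n + 1) / 2 ^ (n + 1)
          = 2 ^ (e * (n + 1)) * (1 / pop a (n + 1)) := by
        rw [dens, add_mul, one_mul, pow_add]
        field_simp
      rw [h2]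
      have h3 := gauge_level_le hdbl (n + 1) 1
      rw [pow_one] at h3
      refine mul_le_mul_of_nonneg_left ((hK (n + 1)).trans ?_) (by positivity)
      exact mul_le_mul_of_nonneg_left h3 hK0.le
    have h4 : (((n + 1 : ℕ) : ℝ) + 1) ≤ 2 * (n + 1 : ℕ) := by
      push_cast
      have : (0 : ℝ) ≤ n := by positivity
      linarith
    have hhp := (hh.pos ((2 : ℝ)⁻¹ ^ (n + 2)) (by positivity)).le
    calc G * ((((n + 1 : ℕ) : ℝ) + 1) * (dens (1 + e) a (n + 1) / 2 ^ (n + 1)))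
        ≤ G * ((2 * (n + 1 : ℕ)) *
          (2 ^ (e * (n + 1)) * (K * (2 ^ (1 + e) * h ((2 : ℝ)⁻¹ ^ (n + 2)))))) := by
          have := dens_nonneg (d := 1 + e) a (n + 1)
          gcongr
      _ = D * X n := by
          simp only [hD, X]
          field_simp
  refine (summable_nat_add_iff 1).1 ?_
  refine Summable.of_nonneg_of_le (fun n => Real.sqrt_nonneg _) (fun n => ?_)
    (hsum.mul_left (√D * 2))
  refine (hup n).trans ?_
  rw [mul_assoc]
  refine mul_le_mul_of_nonneg_left ?_ (Real.sqrt_nonneg _)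
  linarith [hlow n]

/-- The populations of the greedy branching sequence: branch whenever this keeps the population
below `1 / h(2⁻ⁿ)`. -/
noncomputable def greedyPop (d : ℕ) (h : ℝ → ℝ) : ℕ → ℕ
  | 0 => 1
  | n + 1 => if (greedyPop d h n : ℝ) * 2 ^ d * h ((2 : ℝ)⁻¹ ^ (n + 1)) ≤ 1
      then greedyPop d h n * 2 ^ d else greedyPop d h n

/-- The greedy branching sequence. -/
noncomputable def greedySeq (d : ℕ) (h : ℝ → ℝ) (n : ℕ) : ℕ :=
  if (greedyPop d h n : ℝ) * 2 ^ d * h ((2 : ℝ)⁻¹ ^ (n + 1)) ≤ 1 then 2 ^ d else 1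

lemma pop_greedySeq (d : ℕ) (h : ℝ → ℝ) (n : ℕ) : pop (greedySeq d h) n = greedyPop d h n := by
  induction n with
  | zero => simp [pop, greedyPop]
  | succ n ih =>
    rw [pop_succ, ih, greedySeq, greedyPop]
    split_ifs <;> simp

lemma greedySeq_mem (d : ℕ) (h : ℝ → ℝ) (n : ℕ) :
    greedySeq d h n = 1 ∨ greedySeq d h n = 2 ^ d := by
  unfold greedySeq
  split_ifs
  · exact Or.inr rfl
  · exact Or.inl rfl

lemma inv_two_pow_succ_le (hh : IsGauge h) (n : ℕ) :
    h ((2 : ℝ)⁻¹ ^ (n + 1)) ≤ h ((2 : ℝ)⁻¹ ^ n) :=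
  hh.mono (show (0 : ℝ) < _ by positivity) (show (0 : ℝ) < _ by positivity)
    (pow_le_pow_of_le_one (by norm_num) (by norm_num) n.le_succ)

/-- No constant depending on `h` enters; therefore the covering constant can depend on `d` alone. -/
lemma pop_greedySeq_le (hh : IsGauge h) (n : ℕ) :
    (pop (greedySeq d h) n : ℝ) ≤ max 1 (1 / h ((2 : ℝ)⁻¹ ^ n)) := by
  rw [pop_greedySeq]
  induction n with
  | zero => simp [greedyPop]
  | succ n ih =>
    have hp := hh.pos ((2 : ℝ)⁻¹ ^ (n + 1)) (by positivity)
    rw [greedyPop]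
    split_ifs with hc
    · refine le_max_of_le_right ?_
      rw [le_div_iff₀ hp]
      push_cast
      exact hc
    · exact ih.trans (max_le_max le_rfl
        (one_div_le_one_div_of_le hp (inv_two_pow_succ_le hh n)))

/-- Branching multiplies the population by 2^d while `h` drops by at most that factor, so the
product does not decrease; if branching is refused, the product exceeds 2^(-d). -/
lemma le_pop_greedySeq (hh : IsGauge h) (hdbl : ∀ t : ℝ, 0 < t → h (2 * t) ≤ 2 ^ d * h t) (n : ℕ) :
    min (h 1) (2 ^ d)⁻¹ ≤ pop (greedySeq d h) n * h ((2 : ℝ)⁻¹ ^ n) := by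
  rw [pop_greedySeq]
  induction n with
  | zero => simp [greedyPop]
  | succ n ih =>
    have hp := hh.pos ((2 : ℝ)⁻¹ ^ (n + 1)) (by positivity)
    rw [greedyPop]
    split_ifs with hc
    · refine ih.trans ?_
      have h1 := gauge_level_le hdbl n 1
      rw [pow_one] at h1
      push_cast
      rw [mul_assoc]
      gcongr
    · refine (min_le_right _ _).trans ?_
      rw [inv_le_iff_one_le_mul₀ (by positivity)]
      push Not at hc
      linarith

lemma isBranchingSequence_greedySeq (hh : IsGauge h)
    (hdbl : ∀ t : ℝ, 0 < t → h (2 * t) ≤ 2 ^ d * h t) :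
    IsBranchingSequence d h (greedySeq d h) := by
  have h1 : 0 < h 1 := hh.pos 1 one_pos
  set b := min (h 1) ((2 : ℝ) ^ d)⁻¹ with hb
  have hb0 : 0 < b := lt_min h1 (by positivity)
  refine ⟨greedySeq_mem d h, max b⁻¹ (max 1 (h 1)), lt_max_of_lt_left (inv_pos.2 hb0),
    fun n => ?_⟩
  have hp := hh.pos ((2 : ℝ)⁻¹ ^ n) (by positivity)
  rw [← cast_pop, div_le_iff₀ hp, le_div_iff₀ hp]
  constructor
  · refine le_trans ?_ (le_pop_greedySeq hh hdbl n)
    rw [← hb]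
    exact inv_le_of_inv_le₀ hb0 (le_max_left _ _)
  · refine le_trans ?_ (le_max_right _ _)
    refine (mul_le_mul_of_nonneg_right (pop_greedySeq_le hh n) hp.le).trans ?_
    rw [max_mul_of_nonneg _ _ hp.le, one_mul, one_div, inv_mul_cancel₀ hp.ne']
    refine max_le (le_max_of_le_right ?_) (le_max_left _ _)
    exact hh.mono (show (0 : ℝ) < _ by positivity) (show (0 : ℝ) < 1 from one_pos)
      (pow_le_one₀ (by norm_num) (by norm_num))

/-- Cubes `d` levels deeper have diameter at most √d 2^(-d) 2^(-n) ≤ 2^(-n), so one ball per cube is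
enough. -/
lemma exists_cover_limitSet {n : ℕ} {b : ℝ} (hb : (pop a (n + d) : ℝ) ≤ b)
    (ha : ∀ n, a n = 1 ∨ a n = 2 ^ d) :
    ∃ c : Finset (E d), (c.card : ℝ) ≤ b ∧
      limitSet a ω ⊆ ⋃ x ∈ c, Metric.closedBall x ((2 : ℝ)⁻¹ ^ n) := by
  classical
  choose x hx using fun k : Fin d → ℕ => dyadicCube_nonempty (n + d) k
  refine ⟨(surv a ω (n + d)).image x, ?_, fun y hy => ?_⟩
  · refine le_trans ?_ hb
    rw [← card_surv (ω := ω) ha]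
    exact_mod_cast Finset.card_image_le
  · have h1 := mem_iInter.1 hy (n + d)
    rw [stageSet_eq] at h1
    obtain ⟨k, hk, hyk⟩ := mem_iUnion₂.1 h1
    refine mem_iUnion₂.2 ⟨x k, Finset.mem_image_of_mem x hk, ?_⟩
    rw [Metric.mem_closedBall]
    refine (dist_le_of_mem_dyadicCube hyk (hx k)).trans ?_
    calc √(d : ℝ) * (2 : ℝ)⁻¹ ^ (n + d) ≤ 2 ^ d * (2 : ℝ)⁻¹ ^ (n + d) := by
          gcongr
          exact sqrt_natCast_le_two_pow d
      _ = (2 : ℝ)⁻¹ ^ n * (2 * 2⁻¹) ^ d := by rw [pow_add, mul_pow]; ring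
      _ = (2 : ℝ)⁻¹ ^ n := by norm_num

/-- Almost surely the limit set of the random construction has all the asserted properties. -/
lemma ae_isNonTubeNullSet (hd : 1 ≤ d) (hh : IsGauge h)
    (hdbl : ∀ t : ℝ, 0 < t → h (2 * t) ≤ 2 ^ d * h t)
    (hint : IntegrableOn (fun t : ℝ => t⁻¹ * √(t ^ (1 - (d : ℤ)) * |Real.log t| * h t)) (Ioo 0 1))
    (hbr : IsBranchingSequence d h a) {C : ℝ}
    (hC : ∀ n, (pop a (n + d) : ℝ) ≤ max 1 (C / h ((2 : ℝ)⁻¹ ^ n))) :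
    ∀ᵐ ω ∂(choiceMeasure d), IsNonTubeNullSet h C (limitSet a ω) := by
  obtain ⟨ha, K, hK0, hK⟩ := hbr
  have hgp : ∀ n : ℕ, 0 < h ((2 : ℝ)⁻¹ ^ n) := fun n => hh.pos _ (by positivity)
  have hpop : ∀ n, (0 : ℝ) < pop a n := fun n => by exact_mod_cast pop_pos ha n
  have hKup : ∀ n, (pop a n : ℝ) * h ((2 : ℝ)⁻¹ ^ n) ≤ K := fun n => by
    rw [cast_pop, ← le_div_iff₀ (hgp n)]
    exact (hK n).2
  have hKlow : ∀ n, 1 / (pop a n : ℝ) ≤ K * h ((2 : ℝ)⁻¹ ^ n) := fun n => by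
    have h1 := (hK n).1
    rw [← cast_pop, div_le_iff₀ (hgp n), inv_le_iff_one_le_mul₀ hK0] at h1
    rw [div_le_iff₀ (hpop n)]
    linarith
  filter_upwards [ae_exists_lineAverage_le ha (summable_growth hd hh hdbl hint hK0 hKlow)]
    with ω ⟨M, hM⟩
  have hpos : 0 < hausdorffGauge d h (limitSet a ω) :=
    hausdorffGauge_limitSet_pos hh hdbl ha hK0 hKlow
  have hfin : hausdorffGauge d h (limitSet a ω) < ∞ := by
    refine (hausdorffGauge_le hh hdbl ha hKup zero_le_one Subset.rfl
      (Eventually.of_forall fun n => ?_)).trans_lt ENNReal.ofReal_lt_top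
    exact (div_le_one (hpop n)).2 (by exact_mod_cast card_meet_le_pop ha n _)
  have hnull : ∀ B : Set (E d), B ⊆ limitSet a ω → MeasurableSet B →
      0 < hausdorffGauge d h B → ¬ IsTubeNull B := fun B hB hBm hBpos =>
    not_isTubeNull_of_lineAverage_le hd hh hdbl ha hKup (le_max_left 1 M)
      (fun n j₀ p v hl => (hM n j₀ p v hl).trans (le_max_right 1 M)) hfin hB hBm hBpos
  exact ⟨isCompact_limitSet, fun n => exists_cover_limitSet (hC n) ha, hpos, hfin, hnull,
    hnull _ Subset.rfl isCompact_limitSet.measurableSet hpos⟩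

end TubeNull

theorem theorem1p2 (d : ℕ) (hd : 1 ≤ d) :
    ∃ C : ℝ, 0 < C ∧ ∀ h : ℝ → ℝ, TubeNull.IsGauge h →
      (∀ t : ℝ, 0 < t → h (2 * t) ≤ 2 ^ d * h t) →
      IntegrableOn (fun t : ℝ => t⁻¹ * √(t ^ (1 - (d : ℤ)) * |Real.log t| * h t)) (Ioo 0 1) →
      (∃ A : Set (TubeNull.E d), TubeNull.IsNonTubeNullSet h C A) ∧
      (∃ a : ℕ → ℕ, TubeNull.IsBranchingSequence d h a ∧
        ∀ᵐ ω ∂(TubeNull.choiceMeasure d),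
          TubeNull.IsNonTubeNullSet h C (TubeNull.limitSet a ω)) ∧
      (∀ a : ℕ → ℕ, TubeNull.IsBranchingSequence d h a →
        ∃ C' : ℝ, 0 < C' ∧ ∀ᵐ ω ∂(TubeNull.choiceMeasure d),
          TubeNull.IsNonTubeNullSet h C' (TubeNull.limitSet a ω)) := by
  -- The cover uses cubes of level `n + d`; each of the `d` doublings back to level `n` costs a
  -- factor 2^d.
  refine ⟨(2 ^ d) ^ d, by positivity, fun h hh hdbl hint => ?_⟩
  have hgp : ∀ n : ℕ, 0 < h ((2 : ℝ)⁻¹ ^ n) := fun n => hh.pos _ (by positivity)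
  have hdiv : ∀ (n : ℕ) {K : ℝ}, 0 ≤ K →
      K / h ((2 : ℝ)⁻¹ ^ (n + d)) ≤ (2 ^ d) ^ d * K / h ((2 : ℝ)⁻¹ ^ n) := by
    intro n K hK
    rw [div_le_div_iff₀ (hgp _) (hgp _)]
    have := mul_le_mul_of_nonneg_left (TubeNull.gauge_level_le hdbl n d) hK
    linarith
  have hgreedy := TubeNull.isBranchingSequence_greedySeq hh hdbl
  have hae : ∀ᵐ ω ∂(TubeNull.choiceMeasure d),
      TubeNull.IsNonTubeNullSet h ((2 ^ d) ^ d) (TubeNull.limitSet (TubeNull.greedySeq d h) ω) := by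
    refine TubeNull.ae_isNonTubeNullSet hd hh hdbl hint hgreedy fun n => ?_
    refine (TubeNull.pop_greedySeq_le hh (n + d)).trans (max_le_max le_rfl ?_)
    simpa only [mul_one] using hdiv n zero_le_one
  refine ⟨?_, ⟨_, hgreedy, hae⟩, fun a ha => ?_⟩
  · obtain ⟨ω, hω⟩ := hae.exists
    exact ⟨_, hω⟩
  · obtain ⟨K, hK0, hK⟩ := ha.theta
    refine ⟨(2 ^ d) ^ d * K, by positivity,
      TubeNull.ae_isNonTubeNullSet hd hh hdbl hint ha fun n => le_max_of_le_right ?_⟩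
    rw [TubeNull.cast_pop]
    exact (hK (n + d)).2.trans (hdiv n hK0.le)
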